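/- Let $T=\{T(x):x\in S^2\}$ be a real, jointly measurable, zero-mean Gaussian random field on the unit sphere $S^2\subset\mathbb R^3$, isotropic in the sense that its finite-dimensional distributions are invariant under every rotation in $SO(3)$. Write $dy$ for the surface measure on $S^2$ (total mass $4\pi$), $P_\ell$ for the Legendre polynomials, $a_{\ell m}=\int_{S^2}T(y)\overline{Y_{\ell m}(y)}\,dy$ for the random spherical harmonic coefficients, where $Y_{\ell m}$ are the orthonormal spherical harmonics, and $C_\ell=\mathbb E|a_{\ell m}|^2$ (independent of $m$ by isotropy) for the angular power spectrum of $T$. Let $B>1$, let $b:\mathbb R\to\mathbb R$ vanish outside $[B^{-1},B]$, let $j\ge 0$ be an integer, and put $$\beta_j(x)=\int_{S^2}\Psi_j(\langle x,y\rangle)T(y)\,dy,\qquad \Psi_j(t)=\sum_{\ell\ge0} b\Big(\frac{\ell}{B^j}\Big)\frac{2\ell+1}{4\pi}P_\ell(t),\qquad \widetilde\beta_j(x)=\frac{\beta_j(x)}{\sqrt{\sum_{\ell} b^2(\ell/B^j)\frac{2\ell+1}{4\pi}C_\ell}} .$$ Assume the normalization $\mathbb E\{\beta_j^2(x)\}=1$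 for every $x\in S^2$ (so that $\widetilde\beta_j=\beta_j$). Let $K:[-1,1]\to\mathbb R$ have a finite expansion $K(t)=\sum_{\ell=0}^{L_K}\frac{2\ell+1}{4\pi}\kappa(\ell)P_\ell(t)$ with real $\kappa(\ell)$, and for an integer $q\ge 3$ let $$g_{j;q}(x)=\int_{S^2}K(\langle x,y\rangle)\,H_q(\widetilde\beta_j(y))\,dy,$$ where $H_q$ is the $q$-th (probabilists') Hermite polynomial, $H_q(u)=(-1)^q e^{u^2/2}\frac{d^q}{du^q}e^{-u^2/2}$. Let $C_{\ell_1m_1\ell_2m_2}^{\ell_3m_3}$ denote the Clebsch–Gordan coefficients in the standard (unitary) normalization, and set $$\mathcal C(\ell_1,\dots,\ell_q,\ell)=\sum_{\lambda_1,\dots,\lambda_{q-2}\ge0}\Big\{C_{\ell_10\,\ell_20}^{\lambda_10}\,C_{\lambda_10\,\ell_30}^{\lambda_20}\cdots C_{\lambda_{q-2}0\,\ell_q0}^{\ell0}\Big\}^2 .$$ Then the field $g_{j;q}$ has finite variance, has mean zero, and is isotropic (its finite-dimensional distributions are invariant under $SO(3)$), and for all $x_1,x_2\in S^2$ $$\mathbb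 E\{g_{j;q}(x_1)g_{j;q}(x_2)\}=q!\sum_{\ell=0}^{L_K}\kappa^2(\ell)\sum_{\ell_1,\dots,\ell_q\ge0}\mathcal C(\ell_1,\dots,\ell_q,\ell)\left[\prod_{k=1}^q b^2\Big(\frac{\ell_k}{B^j}\Big)\frac{2\ell_k+1}{4\pi}C_{\ell_k}\right]P_\ell(\langle x_1,x_2\rangle).$$ All sums are finite. -/

import Mathlib

open MeasureTheory ProbabilityTheory
open scoped Nat

noncomputable section

namespace SphericalField

/-- Euclidean three-space. -/
abbrev E3 : Type := EuclideanSpace ℝ (Fin 3)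

/-- The unit sphere `S²` of Euclidean three-space. -/
abbrev S2 : Type := Metric.sphere (0 : E3) 1

/-- The (unnormalised) surface measure on `S²`, of total mass `4π`. -/
def area : Measure S2 := (volume : Measure E3).toSphere

/-- The scalar product `⟨x, y⟩` of two points of the sphere. -/
def dot (x y : S2) : ℝ := inner ℝ (x : E3) (y : E3)

/-- The action on `S²` of a linear isometry of three-space. -/
def rotate (R : E3 ≃ₗᵢ[ℝ] E3) (x : S2) : S2 :=
  ⟨R x, by simp⟩

/-- A real random field on the sphere is (strongly) isotropic if its finite-dimensional
distributions are invariant under every rotation in `SO(3)`. -/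
def IsIsotropic {Ω : Type*} [MeasurableSpace Ω] (X : S2 → Ω → ℝ) (P : Measure Ω) : Prop :=
  ∀ R : E3 ≃ₗᵢ[ℝ] E3, LinearMap.det (R.toLinearEquiv : E3 →ₗ[ℝ] E3) = 1 →
    ∀ (n : ℕ) (x : Fin n → S2),
      IdentDistrib (fun ω i => X (rotate R (x i)) ω) (fun ω i => X (x i) ω) P P

/-- The Legendre polynomial `P_ℓ`, by Rodrigues' formula
`P_ℓ = (2^ℓ ℓ!)⁻¹ (d/dt)^ℓ (t² - 1)^ℓ`. -/
def legendre (l : ℕ) : Polynomial ℝ :=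
  Polynomial.C (((2 : ℝ) ^ l * (l ! : ℝ))⁻¹) *
    Polynomial.derivative^[l] ((Polynomial.X ^ 2 - 1) ^ l)

/-- The value `P_ℓ(t)`. -/
def legendreP (l : ℕ) (t : ℝ) : ℝ := (legendre l).eval t

/-- The complex orthonormal spherical harmonic `Y_{ℓm}` in Cartesian coordinates: for `m ≥ 0`
`Y_{ℓm}(x) = (-1)^m √((2ℓ+1)/(4π) · (ℓ-m)!/(ℓ+m)!) · P_ℓ^{(m)}(x₃) · (x₁ + i x₂)^m`,
where `P_ℓ^{(m)}` is the `m`-th derivative of `P_ℓ`, and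
`Y_{ℓ,-m} = (-1)^m · conj Y_{ℓm}`. It vanishes if `|m| > ℓ`. -/
def sphericalHarmonic (l : ℕ) (m : ℤ) (x : S2) : ℂ :=
  let k : ℕ := m.natAbs
  let y : ℂ :=
    ((Real.sqrt ((2 * (l : ℝ) + 1) / (4 * Real.pi) * (((l - k)! : ℝ) / ((l + k)! : ℝ))) *
        (Polynomial.derivative^[k] (legendre l)).eval ((x : E3) 2) : ℝ) : ℂ) *
      (((x : E3) 0 : ℂ) + Complex.I * ((x : E3) 1 : ℂ)) ^ k
  if 0 ≤ m then (-1) ^ k * y else (starRingEnd ℂ) y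

/-- The random spherical harmonic coefficient `a_{ℓm} = ∫ T(y) conj (Y_{ℓm}(y)) dy`. -/
def harmonicCoeff {Ω : Type*} (T : S2 → Ω → ℝ) (l : ℕ) (m : ℤ) (ω : Ω) : ℂ :=
  ∫ y, (T y ω : ℂ) * (starRingEnd ℂ) (sphericalHarmonic l m y) ∂area

/-- The angular power spectrum `C_ℓ = E|a_{ℓm}|²`. For an isotropic field this does not depend
on `m`; the value `m = 0` is used. -/
def angularPower {Ω : Type*} [MeasurableSpace Ω] (P : Measure Ω) (T : S2 → Ω → ℝ) (l : ℕ) : ℝ :=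
  ∫ ω, ‖harmonicCoeff T l 0 ω‖ ^ 2 ∂P

/-- The needlet kernel `Ψ_j(t) = ∑_ℓ b(ℓ/B^j) (2ℓ+1)/(4π) P_ℓ(t)`
(a finite sum when `b` has compact support). -/
def needletKernel (b : ℝ → ℝ) (B : ℝ) (j : ℕ) (t : ℝ) : ℝ :=
  ∑' l : ℕ, b ((l : ℝ) / B ^ j) * ((2 * (l : ℝ) + 1) / (4 * Real.pi)) * legendreP l t

/-- The needlet field `β_j(x) = ∫ Ψ_j(⟨x, y⟩) T(y) dy`. -/
def needletField {Ω : Type*} (T : S2 → Ω → ℝ) (b : ℝ → ℝ) (B : ℝ) (j : ℕ)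
    (x : S2) (ω : Ω) : ℝ :=
  ∫ y, needletKernel b B j (dot x y) * T y ω ∂area

/-- The normalised field
`β̃_j(x) = β_j(x) / √(∑_ℓ b²(ℓ/B^j) (2ℓ+1)/(4π) C_ℓ)`. -/
def normalizedNeedletField {Ω : Type*} [MeasurableSpace Ω] (P : Measure Ω) (T : S2 → Ω → ℝ)
    (b : ℝ → ℝ) (B : ℝ) (j : ℕ) (x : S2) (ω : Ω) : ℝ :=
  needletField T b B j x ω /
    Real.sqrt (∑' l : ℕ, b ((l : ℝ) / B ^ j) ^ 2 *
      ((2 * (l : ℝ) + 1) / (4 * Real.pi)) * angularPower P T l)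

/-- The smoothed nonlinear transform
`g_{j;q}(x) = ∫ K(⟨x, y⟩) H_q(β̃_j(y)) dy`, with `H_q` the probabilists' Hermite polynomial. -/
def gField {Ω : Type*} [MeasurableSpace Ω] (P : Measure Ω) (T : S2 → Ω → ℝ)
    (b : ℝ → ℝ) (B : ℝ) (j : ℕ) (K : ℝ → ℝ) (q : ℕ) (x : S2) (ω : Ω) : ℝ :=
  ∫ y, K (dot x y) *
    Polynomial.aeval (normalizedNeedletField P T b B j y ω) (Polynomial.hermite q) ∂area

/-- The factorial of a nonnegative integer, as a real number (only used for `0 ≤ n`). -/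
def intFactorial (n : ℤ) : ℝ := (n.toNat ! : ℝ)

/-- The Clebsch–Gordan coefficient `C_{l₁ m₁ l₂ m₂}^{l₃ m₃}` (standard unitary normalisation),
by Racah's formula; the sum runs over all `k` for which every factorial has a nonnegative
argument. It is `0` outside the selection rules. -/
def clebschGordan (l₁ : ℕ) (m₁ : ℤ) (l₂ : ℕ) (m₂ : ℤ) (l₃ : ℕ) (m₃ : ℤ) : ℝ :=
  if m₁ + m₂ = m₃ ∧ |m₁| ≤ l₁ ∧ |m₂| ≤ l₂ ∧ |m₃| ≤ l₃ ∧
      l₁ ≤ l₂ + l₃ ∧ l₂ ≤ l₁ + l₃ ∧ l₃ ≤ l₁ + l₂ then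
    Real.sqrt ((2 * (l₃ : ℝ) + 1) * intFactorial (l₃ + l₁ - l₂) * intFactorial (l₃ - l₁ + l₂) *
        intFactorial (l₁ + l₂ - l₃) / intFactorial (l₁ + l₂ + l₃ + 1)) *
      Real.sqrt (intFactorial (l₃ + m₃) * intFactorial (l₃ - m₃) * intFactorial (l₁ - m₁) *
        intFactorial (l₁ + m₁) * intFactorial (l₂ - m₂) * intFactorial (l₂ + m₂)) *
      ∑ k ∈ (Finset.range (l₁ + l₂ + 1)).filter (fun k : ℕ =>
          0 ≤ (l₁ : ℤ) + l₂ - l₃ - k ∧ 0 ≤ (l₁ : ℤ) - m₁ - k ∧ 0 ≤ (l₂ : ℤ) + m₂ - k ∧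
          0 ≤ (l₃ : ℤ) - l₂ + m₁ + k ∧ 0 ≤ (l₃ : ℤ) - l₁ - m₂ + k),
        (-1 : ℝ) ^ k /
          (intFactorial k * intFactorial (l₁ + l₂ - l₃ - k) * intFactorial (l₁ - m₁ - k) *
            intFactorial (l₂ + m₂ - k) * intFactorial (l₃ - l₂ + m₁ + k) *
            intFactorial (l₃ - l₁ - m₂ + k))
  else 0

/-- The chain of Clebsch–Gordan coefficients
`C_{ℓ₁0 ℓ₂0}^{λ₁0} C_{λ₁0 ℓ₃0}^{λ₂0} ⋯ C_{λ_{q-2}0 ℓ_q0}^{L0}`, where `q = n + 2`. -/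
def cgChain {n : ℕ} (l : Fin (n + 2) → ℕ) (lam : Fin n → ℕ) (L : ℕ) : ℝ :=
  let path : Fin (n + 2) → ℕ := Fin.cons (l 0) (Fin.snoc lam L : Fin (n + 1) → ℕ)
  ∏ k : Fin (n + 1), clebschGordan (path k.castSucc) 0 (l k.succ) 0 (path k.succ) 0

/-- The quantity `𝒞(ℓ₁, …, ℓ_q, L) = ∑_{λ₁, …, λ_{q-2}} (C_{ℓ₁0 … ℓ_q0}^{λ₁ … λ_{q-2} L0})²`
for `q ≥ 2`; all but finitely many terms vanish. (The values for `q ≤ 1` are the empty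
coupling, included only to have a total definition.) -/
def cgConvolution : (q : ℕ) → (Fin q → ℕ) → ℕ → ℝ
  | 0, _, L => if L = 0 then 1 else 0
  | 1, l, L => if l 0 = L then 1 else 0
  | n + 2, l, L => ∑' lam : Fin n → ℕ, cgChain (n := n) l lam L ^ 2

end SphericalField

end

open SphericalField

noncomputable section

namespace SphericalField

/-! ### Legendre polynomials: Bonnet's recurrence and expansions in them. -/

section Legendre

open Polynomial

/-! Write `Γ = covK P T` for the covariance of `T`, `K_ℓ = legK ℓ` for the kernel `(2ℓ+1)/(4π)
P_ℓ(⟨x,y⟩)`, and `*` for composition of kernels (`conv`). Since `SO(3)` is transitive on pairs of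
points at a given distance, isotropy makes `Γ` zonal. Zonal kernels commute, and each `K_ℓ` is an
eigenkernel: `K_ℓ * Γ = C_ℓ K_ℓ` (`conv_legK_eq`). The eigenvalue is the angular power because
`Y_{ℓ0}` is a multiple of `K_ℓ(pole, ·)` (`angularPower_eq`).

The needlet field therefore has covariance `ρ = Ψ * Γ * Ψ = ∑ b² C_ℓ K_ℓ`. It is Gaussian, since
integrals of `T` are `L²` limits of finite linear combinations. Mehler's formula gives the Hermite
field the covariance `q! ρ^q`. Iterating `P_m P_n = ∑_L (C_{m0 n0}^{L0})² P_L` (`prod_legendreP`)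
linearises `ρ^q`, with coefficients built from `𝒞`. Smoothing by `K` on both sides multiplies degree
`ℓ` by `κ(ℓ)²`.

The product formula is proved by induction from Bonnet's recurrence, with the squared `3j` symbols
in closed form; Dixon's identity evaluates Racah's sum at `m = 0` and identifies them with
Clebsch–Gordan coefficients. The reproducing property `K_k * K_ℓ = δ_{kℓ} K_ℓ` comes from Legendre
orthogonality and commutativity, without an addition theorem.

For isotropy of `g`: a band-limited field is almost surely determined, linearly, by its values at
finitely many points. Finite-dimensional vectors of `g` are thus a fixed measurable function of a
centred Gaussian vector, whose law depends only on its rotation-invariant covariance. -/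

theorem iterate_derivative_X_mul_succ (n : ℕ) (p : ℝ[X]) :
    derivative^[n + 1] (X * p) = X * derivative^[n + 1] p + ((n : ℝ[X]) + 1) * derivative^[n] p := by
  induction n with
  | zero => simp [derivative_mul]; ring
  | succ n ih =>
    rw [Function.iterate_succ_apply', ih]
    simp only [derivative_add, derivative_mul, derivative_X, derivative_natCast, derivative_one,
      ← Function.iterate_succ_apply' (f := derivative)]
    push_cast
    ring

/-- Three-term recurrence for the unnormalised Rodrigues polynomials. -/
theorem rodrigues_succ_succ (n : ℕ) :
    derivative^[n + 2] ((X ^ 2 - 1 : ℝ[X]) ^ (n + 2)) =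
      2 * (2 * (n : ℝ[X]) + 3) * (X * derivative^[n + 1] ((X ^ 2 - 1 : ℝ[X]) ^ (n + 1))) -
        4 * ((n : ℝ[X]) + 1) ^ 2 * derivative^[n] ((X ^ 2 - 1 : ℝ[X]) ^ n) := by
  -- Differentiating `(X² - 1)^(n+2)` once, then twice, by hand gives two formulas for the left
  -- side. Each involves `E`, which is eliminated between them.
  set E := derivative^[n] ((X ^ 2 - 1 : ℝ[X]) ^ (n + 1)) with hE
  have d1 : derivative ((X ^ 2 - 1 : ℝ[X]) ^ (n + 2)) =
      ((2 * (n + 2) : ℕ) : ℝ[X]) * (X * (X ^ 2 - 1 : ℝ[X]) ^ (n + 1)) := by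
    rw [derivative_pow]
    simp [map_ofNat C]
    ring
  have d2 : derivative (derivative ((X ^ 2 - 1 : ℝ[X]) ^ (n + 2))) =
      ((2 * (n + 2) * (2 * n + 3) : ℕ) : ℝ[X]) * (X ^ 2 - 1) ^ (n + 1) +
        ((4 * (n + 1) * (n + 2) : ℕ) : ℝ[X]) * (X ^ 2 - 1) ^ n := by
    rw [d1, derivative_mul, derivative_mul, derivative_pow]
    simp
    ring
  have h1 : derivative^[n + 2] ((X ^ 2 - 1 : ℝ[X]) ^ (n + 2)) =
      ((2 * (n + 2) : ℕ) : ℝ[X]) * (X * derivative^[n + 1] ((X ^ 2 - 1 : ℝ[X]) ^ (n + 1)) +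
        ((n : ℝ[X]) + 1) * E) := by
    rw [Function.iterate_succ_apply, d1, iterate_derivative_natCast_mul,
      iterate_derivative_X_mul_succ]
  have h2 : derivative^[n + 2] ((X ^ 2 - 1 : ℝ[X]) ^ (n + 2)) =
      ((2 * (n + 2) * (2 * n + 3) : ℕ) : ℝ[X]) * E +
        ((4 * (n + 1) * (n + 2) : ℕ) : ℝ[X]) * derivative^[n] ((X ^ 2 - 1 : ℝ[X]) ^ n) := by
    rw [Function.iterate_succ_apply, Function.iterate_succ_apply, d2, iterate_map_add,
      iterate_derivative_natCast_mul, iterate_derivative_natCast_mul]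
  have hn : ((n : ℝ[X]) + 2) ≠ 0 := by
    exact_mod_cast (Nat.cast_ne_zero (R := ℝ[X])).2 (by omega : n + 2 ≠ 0)
  push_cast at h1 h2
  apply mul_left_cancel₀ hn
  linear_combination (2 * (n : ℝ[X]) + 3) * h1 - ((n : ℝ[X]) + 1) * h2

theorem legendre_zero : legendre 0 = 1 := by simp [legendre]

theorem legendre_one : legendre 1 = X := by
  have h : (X ^ 2 - 1 : ℝ[X]).derivative = C 2 * X := by
    simp [map_ofNat C, one_add_one_eq_two]
  simp only [legendre, pow_one, Function.iterate_one, h]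
  rw [← mul_assoc, ← C_mul]
  norm_num

/-- Bonnet's recurrence. -/
theorem legendre_succ_succ (n : ℕ) :
    ((n : ℝ[X]) + 2) * legendre (n + 2) =
      (2 * (n : ℝ[X]) + 3) * (X * legendre (n + 1)) - ((n : ℝ[X]) + 1) * legendre n := by
  have key := rodrigues_succ_succ n
  have q (k : ℕ) : derivative^[k] ((X ^ 2 - 1 : ℝ[X]) ^ k) =
      C ((2 : ℝ) ^ k * (k ! : ℝ)) * legendre k := by
    rw [legendre, ← mul_assoc, ← C_mul, mul_inv_cancel₀ (by positivity), C_1, one_mul]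
  rw [q, q, q] at key
  have hn : (C ((2 : ℝ) ^ (n + 2) * ((n + 1) ! : ℝ)) : ℝ[X]) ≠ 0 := by
    rw [Ne, C_eq_zero]; positivity
  apply mul_left_cancel₀ hn
  have e (k : ℕ) : (C ((k ! : ℕ) : ℝ) : ℝ[X]) = ((k ! : ℕ) : ℝ[X]) := by simp
  simp only [C_mul, e, C_pow, C_ofNat] at key ⊢
  simp only [Nat.factorial_succ] at key ⊢
  push_cast at key ⊢
  linear_combination key

theorem legendreP_zero (t : ℝ) : legendreP 0 t = 1 := by simp [legendreP, legendre_zero]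

theorem legendreP_one (t : ℝ) : legendreP 1 t = t := by simp [legendreP, legendre_one]

theorem legendreP_succ_succ (n : ℕ) (t : ℝ) :
    ((n : ℝ) + 2) * legendreP (n + 2) t =
      (2 * (n : ℝ) + 3) * (t * legendreP (n + 1) t) - ((n : ℝ) + 1) * legendreP n t := by
  have := congrArg (eval t) (legendre_succ_succ n)
  simpa [legendreP] using this

/-- Bonnet's recurrence solved for `t P_n`. At `n = 0` the truncated index `n - 1` is harmless, its
coefficient being `0`. -/
theorem mul_legendreP (n : ℕ) (t : ℝ) :
    (2 * (n : ℝ) + 1) * (t * legendreP n t) =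
      ((n : ℝ) + 1) * legendreP (n + 1) t + n * legendreP (n - 1) t := by
  cases n with
  | zero => simp [legendreP_zero, legendreP_one]
  | succ n =>
    have := legendreP_succ_succ n t
    rw [Nat.add_sub_cancel]
    push_cast
    linear_combination -this

theorem legendreP_one_right (n : ℕ) : legendreP n 1 = 1 := by
  induction n using Nat.twoStepInduction with
  | zero => exact legendreP_zero _
  | one => exact legendreP_one _
  | more n h0 h1 =>
    have := legendreP_succ_succ n 1
    rw [h0, h1] at this
    have h : ((n : ℝ) + 2) ≠ 0 := by positivity
    apply mul_left_cancel₀ h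
    linear_combination this

theorem continuous_legendreP (n : ℕ) : Continuous (legendreP n) := (legendre n).continuous

theorem natDegree_legendre_le (n : ℕ) : (legendre n).natDegree ≤ n := by
  unfold legendre
  refine (natDegree_C_mul_le _ _).trans ((natDegree_iterate_derivative _ _).trans ?_)
  have h : ((X ^ 2 - 1 : ℝ[X]) ^ n).natDegree ≤ n * 2 :=
    natDegree_pow_le_of_le _ (by compute_degree)
  omega

/-- Every polynomial function of degree at most `n` is a combination of `P_0, …, P_n`. -/
theorem exists_legendre_expansion_pow (n : ℕ) :
    ∃ c : ℕ → ℝ, ∀ t : ℝ, t ^ n = ∑ k ∈ Finset.range (n + 1), c k * legendreP k t := by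
  induction n with
  | zero => exact ⟨fun _ => 1, fun t => by simp [legendreP_zero]⟩
  | succ n ih =>
    obtain ⟨c, hc⟩ := ih
    -- Multiplication by `t` sends `P_k` to `P_{k+1}` and `P_{k-1}` with weights `(k+1)/(2k+1)` and
    -- `k/(2k+1)`; these are the contributions arriving at degree `k` from below and from above.
    refine ⟨fun k => (if k = 0 then 0 else c (k - 1) * k / (2 * k - 1)) +
      (if k < n then c (k + 1) * (k + 1) / (2 * k + 3) else 0), fun t => ?_⟩
    have e1 : t ^ (n + 1) = ∑ k ∈ Finset.range (n + 1),
        (c k * (k + 1) / (2 * k + 1) * legendreP (k + 1) t +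
          c k * k / (2 * k + 1) * legendreP (k - 1) t) := by
      rw [pow_succ, hc, Finset.sum_mul]
      refine Finset.sum_congr rfl fun k _ => ?_
      have h : (2 * (k : ℝ) + 1) ≠ 0 := by positivity
      field_simp
      linear_combination c k * mul_legendreP k t
    rw [e1, Finset.sum_add_distrib]
    simp only [add_mul, Finset.sum_add_distrib]
    congr 1
    · rw [Finset.sum_range_succ' _ (n + 1)]
      simp only [Nat.add_eq_zero_iff, one_ne_zero, and_false, if_false, if_true, zero_mul, add_zero,
        Nat.add_sub_cancel]
      refine Finset.sum_congr rfl fun k _ => ?_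
      push_cast
      congr 2
      ring
    · rw [Finset.sum_range_succ' _ n, Finset.sum_range_succ, Finset.sum_range_succ]
      simp only [lt_irrefl, Nat.lt_asymm (Nat.lt_succ_self n), if_false,
        Nat.cast_zero, mul_zero, zero_div, zero_mul, add_zero, Nat.add_sub_cancel]
      refine Finset.sum_congr rfl fun k hk => ?_
      rw [if_pos (Finset.mem_range.1 hk)]
      push_cast
      congr 2
      ring

theorem exists_legendre_expansion (p : ℝ[X]) (n : ℕ) (hp : p.natDegree ≤ n) :
    ∃ c : ℕ → ℝ, ∀ t : ℝ, p.eval t = ∑ k ∈ Finset.range (n + 1), c k * legendreP k t := by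
  choose c hc using exists_legendre_expansion_pow
  refine ⟨fun k => ∑ i ∈ Finset.range (n + 1), p.coeff i * if k < i + 1 then c i k else 0,
    fun t => ?_⟩
  rw [eval_eq_sum_range' (Nat.lt_succ_of_le hp)]
  simp only [Finset.sum_mul]
  rw [Finset.sum_comm]
  refine Finset.sum_congr rfl fun i hi => ?_
  rw [hc, Finset.mul_sum]
  rw [← Finset.sum_subset (Finset.range_mono (Finset.mem_range.1 hi : i + 1 ≤ n + 1))]
  · refine Finset.sum_congr rfl fun k hk => ?_
    rw [if_pos (Finset.mem_range.1 hk)]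
    ring
  · intro k _ hk
    rw [if_neg (by simpa using hk)]
    ring

end Legendre

/-! ### Squared `3j` symbols and Adams' product formula. -/

section Product

/-- The central binomial coefficient, extended by zero to the negative integers. -/
def centralBinomZ (i : ℤ) : ℝ := if i < 0 then 0 else (i.toNat.centralBinom : ℝ)

theorem centralBinomZ_of_neg {i : ℤ} (h : i < 0) : centralBinomZ i = 0 := if_pos h

theorem centralBinomZ_natCast (n : ℕ) : centralBinomZ n = n.centralBinom := by
  simp [centralBinomZ]

theorem centralBinomZ_zero : centralBinomZ 0 = 1 := by simp [centralBinomZ]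

theorem centralBinomZ_pos {i : ℤ} (h : 0 ≤ i) : 0 < centralBinomZ i := by
  rw [centralBinomZ, if_neg h.not_gt]
  exact_mod_cast Nat.centralBinom_pos _

theorem centralBinomZ_succ (i : ℤ) :
    ((i : ℝ) + 1) * centralBinomZ (i + 1) = 2 * (2 * i + 1) * centralBinomZ i := by
  rcases lt_trichotomy i (-1) with h | rfl | h
  · rw [centralBinomZ_of_neg (by omega), centralBinomZ_of_neg (by omega)]; simp
  · simp [centralBinomZ_of_neg]
  · obtain ⟨n, rfl⟩ := Int.eq_ofNat_of_zero_le (by omega : 0 ≤ i)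
    have := Nat.succ_mul_centralBinom_succ n
    rw [centralBinomZ_natCast, show ((n : ℤ) + 1) = ((n + 1 : ℕ) : ℤ) by push_cast; rfl,
      centralBinomZ_natCast]
    exact_mod_cast this

/-- The squared Wigner `3j` symbol with vanishing lower entries, for the degrees
`a + c`, `b + c`, `a + b`. -/
def wignerSq (a b c : ℤ) : ℝ :=
  centralBinomZ a * centralBinomZ b * centralBinomZ c /
    ((2 * ((a + b + c : ℤ) : ℝ) + 1) * centralBinomZ (a + b + c))

/-- Consecutive central binomials have rational ratios, so after expressing all of them through the
lower ones the claim is an identity of rational functions. -/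
theorem wignerSq_recurrence (a b c : ℤ) (h1 : 0 ≤ a + c - 1) (h2 : 0 ≤ b + c) (h3 : 0 ≤ a + b) :
    (a + c : ℝ) * (2 * (a + b) + 1) * wignerSq a b c =
      (2 * (a + c : ℝ) - 1) * ((a + b) * wignerSq (a - 1) b c +
        (a + b + 1) * wignerSq a (b + 1) (c - 1)) -
      (a + c - 1 : ℝ) * (2 * (a + b) + 1) * wignerSq (a - 1) (b + 1) (c - 1) := by
  unfold wignerSq
  obtain ⟨g, hg⟩ := Int.eq_ofNat_of_zero_le (by omega : 0 ≤ a + b + c - 1)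
  have e1 : a - 1 + b + c = g := by omega
  have e2 : a + (b + 1) + (c - 1) = g + 1 := by omega
  have e3 : a - 1 + (b + 1) + (c - 1) = g := by omega
  have e4 : a + b + c = g + 1 := by omega
  rw [e1, e2, e3, e4]
  have hA := centralBinomZ_succ (a - 1)
  have hB := centralBinomZ_succ b
  have hC := centralBinomZ_succ (c - 1)
  have hG := centralBinomZ_succ g
  have hg0 := centralBinomZ_pos (i := g) (by omega)
  have hgr : (a : ℝ) + b + c = g + 1 := by exact_mod_cast e4
  simp only [sub_add_cancel] at hA hC
  push_cast at hA hB hC hG ⊢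
  have hgn : (0 : ℝ) ≤ g := by positivity
  have hden : centralBinomZ ((g : ℤ) + 1) = 2 * (2 * g + 1) * centralBinomZ g / (g + 1) := by
    rw [eq_div_iff (by positivity)]; linear_combination hG
  rw [hden]
  set x := centralBinomZ (a - 1) with hx
  set y := centralBinomZ b with hy
  set z := centralBinomZ (c - 1) with hz
  set G := centralBinomZ g
  set X := centralBinomZ a with hX
  set Y := centralBinomZ (b + 1) with hY
  set Z := centralBinomZ c with hZ
  have q : (2 * ((g : ℝ) + 1) + 1) ≠ 0 := by positivity
  have q' : (2 * (g : ℝ) + 1) ≠ 0 := by positivity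
  have q'' : ((g : ℝ) + 1) ≠ 0 := by positivity
  have hgr' : (g : ℝ) = a + b + c - 1 := by linarith
  -- The ratio is undefined only at the boundary index, where the lower value is already zero by the
  -- extension to negative integers. The same holds for `b` and `c`.
  have cA : ((a : ℝ) = 0 ∧ x = 0) ∨ ((a : ℝ) ≠ 0 ∧ X = 2 * (2 * (a - 1) + 1) * x / a) := by
    rcases eq_or_ne a 0 with h | h
    · exact Or.inl ⟨by simp [h], by rw [hx, h]; exact centralBinomZ_of_neg (by norm_num)⟩
    · have h' : (a : ℝ) ≠ 0 := by exact_mod_cast h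
      exact Or.inr ⟨h', by rw [eq_div_iff h']; linear_combination hA⟩
  have cC : ((c : ℝ) = 0 ∧ z = 0) ∨ ((c : ℝ) ≠ 0 ∧ Z = 2 * (2 * (c - 1) + 1) * z / c) := by
    rcases eq_or_ne c 0 with h | h
    · exact Or.inl ⟨by simp [h], by rw [hz, h]; exact centralBinomZ_of_neg (by norm_num)⟩
    · have h' : (c : ℝ) ≠ 0 := by exact_mod_cast h
      exact Or.inr ⟨h', by rw [eq_div_iff h']; linear_combination hC⟩
  have cB : ((b : ℝ) = -1 ∧ y = 0) ∨
      ((b : ℝ) + 1 ≠ 0 ∧ Y = 2 * (2 * b + 1) * y / (b + 1)) := by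
    rcases eq_or_ne b (-1) with h | h
    · exact Or.inl ⟨by simp [h], by rw [hy, h]; exact centralBinomZ_of_neg (by norm_num)⟩
    · have h' : (b : ℝ) + 1 ≠ 0 := by
        have : b + 1 ≠ 0 := by omega
        exact_mod_cast this
      exact Or.inr ⟨h', by rw [eq_div_iff h']; linear_combination hB⟩
  clear_value x y z X Y Z
  field_simp
  rw [hgr']
  rcases cA with ⟨ha, rfl⟩ | ⟨ha, rfl⟩ <;> rcases cB with ⟨hb, rfl⟩ | ⟨hb, rfl⟩ <;>
    rcases cC with ⟨hc, rfl⟩ | ⟨hc, rfl⟩ <;> (try simp only [ha, hb, hc]) <;> (try field_simp) <;> ring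

/-- The squared Wigner `3j` symbol `(l₁ l₂ l₃; 0 0 0)²`. -/
def threeJSq (l₁ l₂ l₃ : ℤ) : ℝ :=
  if Even (l₁ + l₂ + l₃) then
    wignerSq ((l₁ + l₃ - l₂) / 2) ((l₂ + l₃ - l₁) / 2) ((l₁ + l₂ - l₃) / 2)
  else 0

theorem threeJSq_eq (a b c : ℤ) : threeJSq (a + c) (b + c) (a + b) = wignerSq a b c := by
  rw [threeJSq, if_pos ⟨a + b + c, by ring⟩]
  congr 1 <;> omega

theorem threeJSq_eq_zero {l₁ l₂ l₃ : ℤ} (h : l₂ + l₃ < l₁ ∨ l₁ + l₃ < l₂ ∨ l₁ + l₂ < l₃) :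
    threeJSq l₁ l₂ l₃ = 0 := by
  rw [threeJSq]
  split_ifs with he
  · obtain ⟨g, hg⟩ := he
    rw [wignerSq]
    rcases h with h | h | h
    · rw [centralBinomZ_of_neg (i := (l₂ + l₃ - l₁) / 2) (by omega)]; simp
    · rw [centralBinomZ_of_neg (i := (l₁ + l₃ - l₂) / 2) (by omega)]; simp
    · rw [centralBinomZ_of_neg (i := (l₁ + l₂ - l₃) / 2) (by omega)]; simp
  · rfl

/-- Exactly what comparing coefficients of `P_L` requires when `P_n` multiplies Bonnet's recurrence
for `P_{m+1}`. All four terms have the same parity of degree sum, so the odd case is trivial. -/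
theorem threeJSq_recurrence (m n L : ℕ) :
    (m + 1 : ℝ) * (2 * L + 1) * threeJSq (m + 1) n L =
      (2 * (m : ℝ) + 1) * (L * threeJSq m n (L - 1) + (L + 1) * threeJSq m n (L + 1)) -
      m * (2 * L + 1) * threeJSq (m - 1) n L := by
  by_cases he : Even ((m : ℤ) + 1 + n + L)
  · obtain ⟨g, hg⟩ := he
    obtain ⟨a, ha⟩ : ∃ a : ℤ, a = g - n := ⟨_, rfl⟩
    obtain ⟨b, hb⟩ : ∃ b : ℤ, b = g - (m + 1) := ⟨_, rfl⟩
    obtain ⟨c, hc⟩ : ∃ c : ℤ, c = g - L := ⟨_, rfl⟩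
    have hm : (m : ℤ) = a + c - 1 := by omega
    have hn : (n : ℤ) = b + c := by omega
    have hL : (L : ℤ) = a + b := by omega
    have key := wignerSq_recurrence a b c (by omega) (by omega) (by omega)
    rw [← threeJSq_eq, ← threeJSq_eq, ← threeJSq_eq, ← threeJSq_eq] at key
    have hm' : (m : ℝ) = a + c - 1 := by exact_mod_cast hm
    have hL' : (L : ℝ) = a + b := by exact_mod_cast hL
    rw [hm, hn, hL, hm', hL']
    ring_nf at key ⊢
    linarith
  · have h0 : ∀ x y z : ℤ, ¬ Even (x + y + z) → threeJSq x y z = 0 := fun x y z h => if_neg h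
    rw [h0 _ _ _ he, h0 _ _ _ (fun h => he (by rw [Int.even_iff] at h ⊢; omega)),
      h0 _ _ _ (fun h => he (by rw [Int.even_iff] at h ⊢; omega)),
      h0 _ _ _ (fun h => he (by rw [Int.even_iff] at h ⊢; omega))]
    simp

theorem threeJSq_zero_left (n L : ℕ) :
    (2 * (L : ℝ) + 1) * threeJSq 0 n L = if L = n then 1 else 0 := by
  split_ifs with h
  · subst h
    have := threeJSq_eq 0 L 0
    rw [zero_add, add_zero, zero_add] at this
    rw [this, wignerSq, centralBinomZ_zero]
    have h' := centralBinomZ_pos (i := L) (by omega)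
    simp only [zero_add, add_zero]
    push_cast
    field_simp
  · rw [threeJSq_eq_zero (by omega), mul_zero]

/-- Adams' product formula for Legendre polynomials. -/
theorem legendreP_mul_legendreP (m n : ℕ) (t : ℝ) (N : ℕ) (hN : m + n < N) :
    legendreP m t * legendreP n t =
      ∑ L ∈ Finset.range N, (2 * (L : ℝ) + 1) * threeJSq m n L * legendreP L t := by
  induction m using Nat.strong_induction_on generalizing N with
  | _ m ih =>
  rcases m with _ | m
  · push_cast
    simp only [threeJSq_zero_left, legendreP_zero, one_mul, ite_mul, zero_mul]
    rw [Finset.sum_ite_eq' , if_pos (Finset.mem_range.2 (by omega))]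
  have h1 := ih m (by omega) (N + 1) (by omega)
  have h1' := ih m (by omega) N (by omega)
  have hm : ((m : ℝ) + 1) ≠ 0 := by positivity
  have h2 : (m : ℝ) * (legendreP (m - 1) t * legendreP n t) =
      m * ∑ L ∈ Finset.range N, (2 * (L : ℝ) + 1) * threeJSq (m - 1) n L * legendreP L t := by
    rcases m with _ | m
    · simp
    · rw [Nat.add_sub_cancel, ih m (by omega) N (by omega)]
      push_cast
      simp only [add_sub_cancel_right]
  have h3 : t * (legendreP m t * legendreP n t) =
      ∑ L ∈ Finset.range N, ((L : ℝ) * threeJSq m n (L - 1) + (L + 1) * threeJSq m n (L + 1)) *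
        legendreP L t := by
    have e : t * (legendreP m t * legendreP n t) =
        ∑ L ∈ Finset.range N, (threeJSq m n L * (L + 1) * legendreP (L + 1) t +
          threeJSq m n L * L * legendreP (L - 1) t) := by
      rw [h1', Finset.mul_sum]
      refine Finset.sum_congr rfl fun L _ => ?_
      linear_combination threeJSq m n L * mul_legendreP L t
    rw [e, Finset.sum_add_distrib, Finset.sum_congr rfl (fun L _ => add_mul _ _ (legendreP L t)),
      Finset.sum_add_distrib]
    -- Shifting the summation index loses nothing: `m + 1 + n < N` makes the symbols of third degree
    -- `N - 1` and `N` vanish by the triangle inequality.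
    obtain ⟨M, rfl⟩ : ∃ M, N = M + 1 := ⟨N - 1, by omega⟩
    congr 1
    · rw [Finset.sum_range_succ, threeJSq_eq_zero (by omega), Finset.sum_range_succ' _ M]
      simp only [Nat.cast_zero, zero_mul, add_zero]
      refine Finset.sum_congr rfl fun L _ => ?_
      push_cast
      rw [add_sub_cancel_right]
      ring
    · rw [Finset.sum_range_succ' _ M, Finset.sum_range_succ, threeJSq_eq_zero (l₃ := (M : ℤ) + 1)
        (by omega)]
      simp only [Nat.cast_zero, mul_zero, zero_mul, add_zero, Nat.add_sub_cancel]
      refine Finset.sum_congr rfl fun L _ => ?_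
      push_cast
      ring
  apply mul_left_cancel₀ hm
  have h4 : ((m : ℝ) + 1) * (legendreP (m + 1) t * legendreP n t) =
      (2 * m + 1) * (t * (legendreP m t * legendreP n t)) -
        m * (legendreP (m - 1) t * legendreP n t) := by
    linear_combination -legendreP n t * mul_legendreP m t
  rw [h4, h2, h3, Finset.mul_sum, Finset.mul_sum, Finset.mul_sum, ← Finset.sum_sub_distrib]
  refine Finset.sum_congr rfl fun L _ => ?_
  push_cast
  linear_combination -legendreP L t * threeJSq_recurrence m n L

end Product

/-! ### Dixon's identity. -/

section ClebschGordan

/-- The reciprocal factorial, extended by zero to the negative integers. -/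
def rfact (i : ℤ) : ℝ := if i < 0 then 0 else ((i.toNat ! : ℝ))⁻¹

theorem rfact_of_neg {i : ℤ} (h : i < 0) : rfact i = 0 := if_pos h

theorem rfact_of_nonneg {i : ℤ} (h : 0 ≤ i) : rfact i = (intFactorial i)⁻¹ := if_neg h.not_gt

theorem rfact_natCast (n : ℕ) : rfact n = (n ! : ℝ)⁻¹ := by simp [rfact]

/-- Valid on all of `ℤ`, because at `i = -1` the factor `i + 1` vanishes; this removes boundary
cases from the summation below. -/
theorem rfact_eq (i : ℤ) : rfact i = (i + 1) * rfact (i + 1) := by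
  rcases lt_trichotomy i (-1) with h | rfl | h
  · rw [rfact_of_neg (by omega), rfact_of_neg (by omega)]; simp
  · simp [rfact]
  · obtain ⟨n, rfl⟩ := Int.eq_ofNat_of_zero_le (by omega : 0 ≤ i)
    rw [show ((n : ℤ) + 1) = ((n + 1 : ℕ) : ℤ) by push_cast; rfl, rfact_natCast, rfact_natCast,
      Nat.factorial_succ]
    push_cast
    have : (n ! : ℝ) ≠ 0 := by positivity
    field_simp

/-- The `i`-th term, up to sign, of Dixon's sum. -/
def dixonTerm (a b c i : ℤ) : ℝ :=
  rfact (a + i) * rfact (a - i) * (rfact (b + i) * rfact (b - i)) *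
    (rfact (c + i) * rfact (c - i))

/-- A Zeilberger-type certificate for the recurrence in `c`: the right side has the form `F(i) +
F(i+1)`, so it telescopes once weighted by `(-1)^i`. -/
theorem dixonTerm_step (a b c i : ℤ) :
    (c + 1) * (b + c + 1) * (c + a + 1) * dixonTerm a b (c + 1) i -
        (a + b + c + 1) * dixonTerm a b c i =
      1 / 2 * ((a + i) * (b + i) * (c + 1 + i) * dixonTerm a b (c + 1) i +
        (a + (i + 1)) * (b + (i + 1)) * (c + 1 + (i + 1)) * dixonTerm a b (c + 1) (i + 1)) := by
  have h1 := rfact_eq (c + i)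
  have h2 := rfact_eq (c - i)
  have ha := rfact_eq (a + i)
  have ha' := rfact_eq (a - (i + 1))
  have hb := rfact_eq (b + i)
  have hb' := rfact_eq (b - (i + 1))
  have hc := rfact_eq (c + 1 + i)
  unfold dixonTerm
  rw [show a - (i + 1) + 1 = a - i by ring] at ha'
  rw [show b - (i + 1) + 1 = b - i by ring] at hb'
  rw [show c + i + 1 = c + 1 + i by ring] at h1
  rw [show c - i + 1 = c + 1 - i by ring] at h2
  rw [h1, h2, show c + 1 - (i + 1) = c - i by ring, ha', hb', h2,
    show a + (i + 1) = a + i + 1 by ring, show b + (i + 1) = b + i + 1 by ring,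
    show c + 1 + (i + 1) = c + 1 + i + 1 by ring, ha, hb, hc]
  push_cast
  ring

/-- Dixon's identity. -/
theorem sum_dixonTerm (a b c : ℕ) (N M : ℕ) (h1 : c ≤ N) (h2 : N + c < M) :
    ∑ k ∈ Finset.range M, (-1 : ℝ) ^ k * dixonTerm a b c (k - N) =
      (-1) ^ N * ((a + b + c) ! / (a ! * b ! * c ! * (a + b) ! * (b + c) ! * (c + a) !)) := by
  induction c with
  | zero =>
    rw [Finset.sum_eq_single_of_mem N (Finset.mem_range.2 (by omega))]
    · have e (n : ℕ) : rfact ((n : ℤ) + 0) = (n ! : ℝ)⁻¹ := by rw [add_zero, rfact_natCast]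
      have e' (n : ℕ) : rfact ((n : ℤ) - 0) = (n ! : ℝ)⁻¹ := by rw [sub_zero, rfact_natCast]
      rw [sub_self, dixonTerm, e, e, e, e', e', e']
      simp only [add_zero, zero_add, Nat.factorial_zero]
      have := Nat.factorial_pos a
      have := Nat.factorial_pos b
      have := Nat.factorial_pos (a + b)
      push_cast
      field_simp
    · intro k _ hk
      rw [dixonTerm]
      rcases lt_or_gt_of_ne hk with h | h
      · rw [rfact_of_neg (i := ((0 : ℕ) : ℤ) + _) (by omega)]; simp
      · rw [rfact_of_neg (i := ((0 : ℕ) : ℤ) - _) (by omega)]; simp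
  | succ c ih =>
    have ih := ih (by omega) (by omega)
    let G : ℕ → ℝ := fun k => -(1 / 2) * (-1 : ℝ) ^ k *
      ((a + ((k : ℝ) - N)) * (b + ((k : ℝ) - N)) * (c + 1 + ((k : ℝ) - N)) *
        dixonTerm a b (c + 1) (k - N))
    have tele := Finset.sum_range_sub G M
    -- Both ends of the telescoping sum vanish. At the lower end either the explicit factor is zero
    -- (`N = c + 1`) or a reciprocal factorial has a negative argument.
    have b1 : ((c : ℝ) + 1 + (((0 : ℕ) : ℝ) - N)) * dixonTerm a b (c + 1) ((0 : ℕ) - N) = 0 := by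
      rcases eq_or_lt_of_le h1 with h | h
      · rw [← h]; push_cast; ring
      · rw [dixonTerm, rfact_of_neg (i := (c : ℤ) + 1 + _) (by push_cast; omega)]; simp
    have b2 : dixonTerm a b (c + 1) ((M : ℕ) - N) = 0 := by
      rw [dixonTerm, rfact_of_neg (i := (c : ℤ) + 1 - _) (by omega)]; simp
    have b3 : G M = 0 := by simp only [G, b2, mul_zero]
    have b4 : G 0 = 0 := by
      simp only [G]
      linear_combination -(1 / 2) * (-1 : ℝ) ^ 0 * (a + (((0 : ℕ) : ℝ) - N)) *
        (b + (((0 : ℕ) : ℝ) - N)) * b1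
    have step : ∀ k ∈ Finset.range M, G (k + 1) - G k =
        ((c : ℝ) + 1) * (b + c + 1) * (c + a + 1) * ((-1 : ℝ) ^ k * dixonTerm a b (c + 1) (k - N)) -
          (a + b + c + 1) * ((-1 : ℝ) ^ k * dixonTerm a b c (k - N)) := fun k _ => by
      have := dixonTerm_step a b c (k - N)
      rw [show (k : ℤ) - N + 1 = ((k + 1 : ℕ) : ℤ) - N by push_cast; ring] at this
      simp only [G]
      push_cast at this ⊢
      rw [pow_succ]
      linear_combination -(-1 : ℝ) ^ k * this
    rw [Finset.sum_congr rfl step, Finset.sum_sub_distrib, ← Finset.mul_sum, ← Finset.mul_sum,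
      ih, b3, b4, sub_zero] at tele
    have e : ((c + 1 : ℕ) : ℤ) = c + 1 := by push_cast; rfl
    rw [e]
    have hpos : ((c : ℝ) + 1) * (b + c + 1) * (c + a + 1) ≠ 0 := by positivity
    apply mul_left_cancel₀ hpos
    rw [sub_eq_zero.1 tele, show a + b + (c + 1) = (a + b + c) + 1 by ring,
      show b + (c + 1) = (b + c) + 1 by ring, show c + 1 + a = (c + a) + 1 by ring]
    simp only [Nat.factorial_succ]
    have := Nat.factorial_pos a
    have := Nat.factorial_pos b
    have := Nat.factorial_pos c
    have := Nat.factorial_pos (a + b)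
    have := Nat.factorial_pos (b + c)
    have := Nat.factorial_pos (c + a)
    push_cast
    field_simp

end ClebschGordan

/-! ### Clebsch–Gordan coefficients at `m = 0` and their chains. -/

section ClebschGordan

/-- Racah's side conditions say that no factorial has a negative argument; with reciprocal
factorials extended by zero they become superfluous. -/
theorem racahSum_eq (l₁ l₂ l₃ d : ℕ) (hd : l₁ + l₂ = l₃ + d) :
    ∑ k ∈ (Finset.range (l₁ + l₂ + 1)).filter (fun k : ℕ =>
          0 ≤ (l₁ : ℤ) + l₂ - l₃ - k ∧ 0 ≤ (l₁ : ℤ) - 0 - k ∧ 0 ≤ (l₂ : ℤ) + 0 - k ∧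
          0 ≤ (l₃ : ℤ) - l₂ + 0 + k ∧ 0 ≤ (l₃ : ℤ) - l₁ - 0 + k),
        (-1 : ℝ) ^ k /
          (intFactorial k * intFactorial (l₁ + l₂ - l₃ - k) * intFactorial (l₁ - 0 - k) *
            intFactorial (l₂ + 0 - k) * intFactorial (l₃ - l₂ + 0 + k) *
            intFactorial (l₃ - l₁ - 0 + k)) =
      ∑ k ∈ Finset.range (d + 1), (-1 : ℝ) ^ k * (rfact k * rfact (d - k) *
        (rfact (l₁ - k) * rfact (l₃ - l₂ + k)) * (rfact (l₂ - k) * rfact (l₃ - l₁ + k))) := by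
  rw [Finset.sum_filter]
  have hsub : Finset.range (d + 1) ⊆ Finset.range (l₁ + l₂ + 1) :=
    Finset.range_mono (by omega)
  rw [← Finset.sum_subset hsub]
  · refine Finset.sum_congr rfl fun k hk => ?_
    have hk' := Finset.mem_range.1 hk
    simp only [sub_zero, add_zero]
    rw [show (l₁ : ℤ) + l₂ - l₃ = d by omega]
    split_ifs with h
    · obtain ⟨h1, h2, h3, h4, h5⟩ := h
      rw [rfact_of_nonneg (i := (k : ℤ)) (by omega), rfact_of_nonneg h1, rfact_of_nonneg h2,
        rfact_of_nonneg h3, rfact_of_nonneg h4, rfact_of_nonneg h5]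
      simp only [div_eq_mul_inv, mul_inv]
      ring
    · symm
      by_cases h2 : 0 ≤ (l₁ : ℤ) - k
      · by_cases h3 : 0 ≤ (l₂ : ℤ) - k
        · by_cases h4 : 0 ≤ (l₃ : ℤ) - l₂ + k
          · rw [rfact_of_neg (i := (l₃ : ℤ) - l₁ + k) (by omega)]; simp
          · rw [rfact_of_neg (not_le.1 h4)]; simp
        · rw [rfact_of_neg (not_le.1 h3)]; simp
      · rw [rfact_of_neg (not_le.1 h2)]; simp
  · intro k _ hk
    rw [if_neg]
    rw [Finset.mem_range] at hk
    omega

/-- The reflection `k ↦ d - k` swaps the factorials in pairs and reverses the sign when `d` is odd.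
-/
theorem racahSum_odd (l₁ l₂ l₃ d : ℕ) (hd : l₁ + l₂ = l₃ + d) (h : Odd d) :
    ∑ k ∈ Finset.range (d + 1), (-1 : ℝ) ^ k * (rfact k * rfact (d - k) *
        (rfact (l₁ - k) * rfact (l₃ - l₂ + k)) * (rfact (l₂ - k) * rfact (l₃ - l₁ + k))) = 0 := by
  apply self_eq_neg.1
  nth_rw 1 [← Finset.sum_range_reflect]
  rw [← Finset.sum_neg_distrib]
  refine Finset.sum_congr rfl fun k hk => ?_
  have hk' := Finset.mem_range.1 hk
  have e : ((d + 1 - 1 - k : ℕ) : ℤ) = d - k := by omega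
  have e2 : (-1 : ℝ) ^ (d + 1 - 1 - k) = -(-1) ^ k := by
    have h1 : (-1 : ℝ) ^ (d - k) * (-1) ^ k = -1 := by
      rw [← pow_add, Nat.sub_add_cancel (by omega), h.neg_one_pow]
    have h2 : (-1 : ℝ) ^ k * (-1) ^ k = 1 := by rw [← mul_pow]; simp
    rw [Nat.add_sub_cancel]
    linear_combination (-1 : ℝ) ^ k * h1 - (-1 : ℝ) ^ (d - k) * h2
  rw [e, e2, show (d : ℤ) - (d - k) = k by ring, show (l₁ : ℤ) - (d - k) = l₃ - l₂ + k by omega,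
    show (l₂ : ℤ) - (d - k) = l₃ - l₁ + k by omega, show (l₃ : ℤ) - l₂ + (d - k) = l₁ - k by omega,
    show (l₃ : ℤ) - l₁ + (d - k) = l₂ - k by omega]
  ring

theorem intFactorial_natCast (n : ℕ) : intFactorial n = (n ! : ℝ) := by simp [intFactorial]

theorem intFactorial_pos (i : ℤ) : 0 < intFactorial i := by
  unfold intFactorial; positivity

/-- When `l₁ + l₂ - l₃ = 2c`, the substitution `l₁ = a + c`, `l₂ = b + c`, `l₃ = a + b` turns
Racah's sum into Dixon's sum centred at `k = c`. Squaring removes the sign and the roots, and the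
factorials regroup into central binomials. -/
theorem clebschGordan_sq (l₁ l₂ l₃ : ℕ) :
    clebschGordan l₁ 0 l₂ 0 l₃ 0 ^ 2 = (2 * (l₃ : ℝ) + 1) * threeJSq l₁ l₂ l₃ := by
  unfold clebschGordan
  split_ifs with h
  swap
  · rw [threeJSq_eq_zero]
    · simp
    · simp at h
      omega
  obtain ⟨_, _, _, _, t1, t2, t3⟩ := h
  obtain ⟨d, hd⟩ : ∃ d, l₁ + l₂ = l₃ + d := ⟨l₁ + l₂ - l₃, by omega⟩
  rw [racahSum_eq l₁ l₂ l₃ d hd]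
  rcases Nat.even_or_odd d with he | ho
  swap
  · rw [racahSum_odd l₁ l₂ l₃ d hd ho, threeJSq, if_neg]
    · simp
    · rw [Int.even_iff]; rw [Nat.odd_iff] at ho; omega
  obtain ⟨c, hc⟩ := he
  obtain ⟨a, ha⟩ : ∃ a, l₁ = a + c := ⟨l₁ - c, by omega⟩
  obtain ⟨b, hb⟩ : ∃ b, l₂ = b + c := ⟨l₂ - c, by omega⟩
  have hl₃ : l₃ = a + b := by omega
  have dix := sum_dixonTerm a b c c (d + 1) le_rfl (by omega)
  have e : ∑ k ∈ Finset.range (d + 1), (-1 : ℝ) ^ k * (rfact k * rfact (d - k) *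
        (rfact (l₁ - k) * rfact (l₃ - l₂ + k)) * (rfact (l₂ - k) * rfact (l₃ - l₁ + k))) =
      (-1) ^ c * ((a + b + c) ! / (a ! * b ! * c ! * (a + b) ! * (b + c) ! * (c + a) !)) := by
    rw [← dix]
    refine Finset.sum_congr rfl fun k _ => ?_
    unfold dixonTerm
    rw [show (a : ℤ) + (k - c) = l₃ - l₂ + k by omega, show (a : ℤ) - (k - c) = l₁ - k by omega,
      show (b : ℤ) + (k - c) = l₃ - l₁ + k by omega, show (b : ℤ) - (k - c) = l₂ - k by omega,
      show (c : ℤ) + (k - c) = k by omega, show (c : ℤ) - (k - c) = d - k by omega]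
    ring
  rw [e, mul_pow, mul_pow, Real.sq_sqrt, Real.sq_sqrt]
  rotate_left
  · have := intFactorial_pos
    exact (mul_pos (mul_pos (mul_pos (mul_pos (mul_pos (this _) (this _)) (this _)) (this _))
      (this _)) (this _)).le
  · have := intFactorial_pos
    have h3 : (0 : ℝ) < 2 * l₃ + 1 := by positivity
    exact (div_pos (mul_pos (mul_pos (mul_pos h3 (this _)) (this _)) (this _)) (this _)).le
  rw [show (l₃ : ℤ) + l₁ - l₂ = (2 * a : ℕ) by omega, show (l₃ : ℤ) - l₁ + l₂ = (2 * b : ℕ) by omega,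
    show (l₁ : ℤ) + l₂ - l₃ = (2 * c : ℕ) by omega,
    show (l₁ : ℤ) + l₂ + l₃ + 1 = (2 * (a + b + c) + 1 : ℕ) by omega]
  simp only [add_zero, sub_zero]
  rw [hl₃, ha, hb]
  simp only [intFactorial_natCast]
  have w := threeJSq_eq a b c
  rw [show ((a + c : ℕ) : ℤ) = a + c by push_cast; rfl, show ((b + c : ℕ) : ℤ) = b + c by push_cast; rfl,
    show ((a + b : ℕ) : ℤ) = a + b by push_cast; rfl, w, wignerSq,
    show ((a : ℤ) + b + c) = ((a + b + c : ℕ) : ℤ) by push_cast; rfl]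
  simp only [centralBinomZ_natCast]
  have cb (n : ℕ) : (n.centralBinom : ℝ) = (2 * n) ! / (n ! * n !) := by
    rw [eq_div_iff (by positivity), Nat.centralBinom, Nat.choose_eq_factorial_div_factorial (by omega),
      show 2 * n - n = n by omega]
    have : n ! * n ! ∣ (2 * n) ! := by
      have := Nat.factorial_mul_factorial_dvd_factorial_add n n
      rwa [← two_mul] at this
    rw [Nat.cast_div this (by positivity)]
    push_cast
    have : (n ! : ℝ) ≠ 0 := by positivity
    field_simp
  rw [cb, cb, cb, cb, Nat.factorial_succ, show c + a = a + c by ring]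
  rw [mul_pow, ← pow_mul, mul_comm c 2, pow_mul, neg_one_sq, one_pow, one_mul]
  push_cast
  have h1 : (a ! : ℝ) ≠ 0 := by positivity
  have h2 : (b ! : ℝ) ≠ 0 := by positivity
  have h3 : (c ! : ℝ) ≠ 0 := by positivity
  have h4 : ((a + b + c) ! : ℝ) ≠ 0 := by positivity
  have h5 : ((a + b) ! : ℝ) ≠ 0 := by positivity
  have h6 : ((a + c) ! : ℝ) ≠ 0 := by positivity
  have h7 : ((b + c) ! : ℝ) ≠ 0 := by positivity
  have h8 : ((2 * (a + b + c)) ! : ℝ) ≠ 0 := by positivity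
  have h9 : (2 * ((a : ℝ) + b + c) + 1) ≠ 0 := by positivity
  generalize ((a + b + c) ! : ℝ) = A at *
  generalize ((2 * (a + b + c)) ! : ℝ) = A' at *
  generalize ((2 * a) ! : ℝ) = A1 at *
  generalize ((2 * b) ! : ℝ) = A2 at *
  generalize ((2 * c) ! : ℝ) = A3 at *
  field_simp

/-- Product of two Legendre polynomials as a combination of squared Clebsch–Gordan coefficients. -/
theorem legendreP_mul_eq_clebschGordan (m n : ℕ) (t : ℝ) (N : ℕ) (hN : m + n < N) :
    legendreP m t * legendreP n t =
      ∑ L ∈ Finset.range N, clebschGordan m 0 n 0 L 0 ^ 2 * legendreP L t := by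
  simp only [clebschGordan_sq]
  exact legendreP_mul_legendreP m n t N hN

theorem clebschGordan_eq_zero {l₁ l₂ l₃ : ℕ} (h : l₁ + l₂ < l₃) :
    clebschGordan l₁ 0 l₂ 0 l₃ 0 = 0 := by
  rw [clebschGordan, if_neg]
  omega

/-- Splits off the last coupling, with `r` the last intermediate degree; this drives every induction
on the number of factors. -/
theorem cgChain_snoc {n : ℕ} (l : Fin (n + 3) → ℕ) (lam : Fin n → ℕ) (r L : ℕ) :
    cgChain (n := n + 1) l (Fin.snoc (α := fun _ => ℕ) lam r) L =
      cgChain (n := n) (Fin.init (α := fun _ => ℕ) l) lam r *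
        clebschGordan r 0 (l (Fin.last _)) 0 L 0 := by
  simp only [cgChain]
  rw [Fin.prod_univ_castSucc, Fin.cons_snoc_eq_snoc_cons]
  congr 1
  · refine Finset.prod_congr rfl fun k _ => ?_
    rw [Fin.snoc_castSucc, ← Fin.castSucc_succ, Fin.snoc_castSucc]
    rfl
  · rw [Fin.snoc_castSucc, Fin.succ_last, Fin.snoc_last, Fin.cons_snoc_eq_snoc_cons, Fin.snoc_last]

theorem cgChain_zero (l : Fin 2 → ℕ) (lam : Fin 0 → ℕ) (L : ℕ) :
    cgChain (n := 0) l lam L = clebschGordan (l 0) 0 (l 1) 0 L 0 := by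
  simp [cgChain, Fin.snoc]

/-- The triangle inequality propagates along the chain. Hence the sum over intermediate degrees is
finite. -/
theorem le_sum_of_cgChain_ne_zero {n : ℕ} (l : Fin (n + 2) → ℕ) (lam : Fin n → ℕ) (L : ℕ)
    (h : cgChain l lam L ≠ 0) : (∀ i, lam i ≤ ∑ k, l k) ∧ L ≤ ∑ k, l k := by
  induction n generalizing L with
  | zero =>
    rw [cgChain_zero] at h
    refine ⟨fun i => i.elim0, ?_⟩
    rw [Fin.sum_univ_two]
    by_contra hc
    exact h (clebschGordan_eq_zero (not_le.1 hc))
  | succ n ih =>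
    rw [← Fin.snoc_init_self (α := fun _ => ℕ) lam, cgChain_snoc] at h
    obtain ⟨h1, h2⟩ := ih _ _ _ (left_ne_zero_of_mul h)
    have h3 : L ≤ lam (Fin.last n) + l (Fin.last _) := by
      by_contra hc
      exact right_ne_zero_of_mul h (clebschGordan_eq_zero (not_le.1 hc))
    have hs : ∑ k, l k = ∑ k, Fin.init (α := fun _ => ℕ) l k + l (Fin.last _) :=
      Fin.sum_univ_castSucc l
    rw [hs]
    refine ⟨fun i => ?_, by omega⟩
    refine Fin.lastCases (by omega) (fun i => ?_) i
    exact (h1 i).trans (by omega)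

theorem cgConvolution_eq_sum {n : ℕ} (l : Fin (n + 2) → ℕ) (L N : ℕ) (hN : ∑ k, l k < N) :
    cgConvolution (n + 2) l L =
      ∑ lam ∈ Fintype.piFinset fun _ : Fin n => Finset.range N, cgChain l lam L ^ 2 := by
  rw [cgConvolution]
  refine tsum_eq_sum fun lam hlam => ?_
  by_contra h
  refine hlam (Fintype.mem_piFinset.2 fun i => Finset.mem_range.2 ?_)
  exact ((le_sum_of_cgChain_ne_zero l lam L (fun h0 => h (by simp [h0]))).1 i).trans_lt hN

theorem cgConvolution_two (l : Fin 2 → ℕ) (L : ℕ) :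
    cgConvolution 2 l L = clebschGordan (l 0) 0 (l 1) 0 L 0 ^ 2 := by
  rw [cgConvolution, tsum_fintype]
  simp [cgChain_zero]

theorem cgConvolution_succ {n : ℕ} (l : Fin (n + 3) → ℕ) (L N : ℕ) (hN : ∑ k, l k < N) :
    cgConvolution (n + 3) l L =
      ∑ r ∈ Finset.range N, cgConvolution (n + 2) (Fin.init (α := fun _ => ℕ) l) r *
        clebschGordan r 0 (l (Fin.last _)) 0 L 0 ^ 2 := by
  have hs : ∑ k, l k = ∑ k, Fin.init (α := fun _ => ℕ) l k + l (Fin.last _) :=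
    Fin.sum_univ_castSucc l
  rw [cgConvolution_eq_sum l L N hN]
  simp_rw [cgConvolution_eq_sum (Fin.init (α := fun _ => ℕ) l) _ N (by omega), Finset.sum_mul]
  rw [← Finset.sum_product']
  refine Finset.sum_nbij' (fun lam => (lam (Fin.last n), Fin.init (α := fun _ => ℕ) lam))
    (fun p => Fin.snoc (α := fun _ => ℕ) p.2 p.1) ?_ ?_ ?_ ?_ ?_
  · intro lam h
    rw [Fintype.mem_piFinset] at h
    exact Finset.mem_product.2 ⟨h _, Fintype.mem_piFinset.2 fun i => h _⟩
  · intro p h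
    obtain ⟨h1, h2⟩ := Finset.mem_product.1 h
    rw [Fintype.mem_piFinset] at h2 ⊢
    intro i
    refine Fin.lastCases ?_ (fun i => ?_) i
    · rw [Fin.snoc_last]; exact h1
    · rw [Fin.snoc_castSucc]; exact h2 i
  · intro lam _
    exact Fin.snoc_init_self _
  · intro p _
    simp
  · intro lam _
    rw [← mul_pow, ← cgChain_snoc, Fin.snoc_init_self]

/-- Product of finitely many Legendre polynomials. -/
theorem prod_legendreP {n : ℕ} (l : Fin (n + 2) → ℕ) (t : ℝ) (N : ℕ) (hN : ∑ k, l k < N) :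
    ∏ k, legendreP (l k) t =
      ∑ L ∈ Finset.range N, cgConvolution (n + 2) l L * legendreP L t := by
  induction n with
  | zero =>
    rw [Fin.sum_univ_two] at hN
    rw [Fin.prod_univ_two, legendreP_mul_eq_clebschGordan _ _ t N hN]
    exact Finset.sum_congr rfl fun L _ => by rw [cgConvolution_two]
  | succ n ih =>
    have hs : ∑ k, l k = ∑ k, Fin.init (α := fun _ => ℕ) l k + l (Fin.last _) :=
      Fin.sum_univ_castSucc l
    -- Degrees `r` beyond the sum of the first degrees have to be discarded: for them `r + l (last)`
    -- could exceed the cutoff required by the two-factor formula.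
    have hz : ∀ r, ∑ k, Fin.init (α := fun _ => ℕ) l k < r →
        cgConvolution (n + 2) (Fin.init (α := fun _ => ℕ) l) r = 0 := fun r hr => by
      rw [cgConvolution_eq_sum _ _ _ (Nat.lt_succ_self _)]
      refine Finset.sum_eq_zero fun lam _ => ?_
      by_contra h
      exact hr.not_ge (le_sum_of_cgChain_ne_zero _ lam r (fun h0 => h (by simp [h0]))).2
    rw [Fin.prod_univ_castSucc]
    have := ih (Fin.init (α := fun _ => ℕ) l) (by omega)
    rw [show ∏ k : Fin (n + 2), legendreP (l k.castSucc) t = _ from this, Finset.sum_mul]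
    simp_rw [cgConvolution_succ l _ N hN, Finset.sum_mul]
    rw [Finset.sum_comm]
    refine Finset.sum_congr rfl fun r _ => ?_
    by_cases hr : ∑ k, Fin.init (α := fun _ => ℕ) l k < r
    · simp [hz r hr]
    · rw [mul_assoc, legendreP_mul_eq_clebschGordan _ _ t N (by omega), Finset.mul_sum]
      exact Finset.sum_congr rfl fun L _ => by ring

end ClebschGordan

/-! ### Rotations and their action on pairs of points. -/

section Rotations

theorem norm_coe_S2 (x : S2) : ‖(x : E3)‖ = 1 := by simp

theorem dot_comm (x y : S2) : dot x y = dot y x := real_inner_comm _ _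

theorem dot_self (x : S2) : dot x x = 1 := by
  rw [dot, real_inner_self_eq_norm_sq, norm_coe_S2, one_pow]

theorem dot_eq_sum (x y : S2) : dot x y = ∑ i, (x : E3) i * (y : E3) i := by
  rw [dot, PiLp.inner_apply]
  exact Finset.sum_congr rfl fun i _ => by simp [mul_comm]

theorem abs_dot_le_one (x y : S2) : |dot x y| ≤ 1 := by
  have := abs_real_inner_le_norm (x : E3) (y : E3)
  rwa [norm_coe_S2, norm_coe_S2, one_mul] at this

theorem dot_mem_Icc (x y : S2) : dot x y ∈ Set.Icc (-1 : ℝ) 1 := abs_le.1 (abs_dot_le_one x y)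

theorem continuous_dot : Continuous (Function.uncurry dot) := by
  unfold dot Function.uncurry
  fun_prop

theorem dot_rotate (R : E3 ≃ₗᵢ[ℝ] E3) (x y : S2) : dot (rotate R x) (rotate R y) = dot x y :=
  R.inner_map_map _ _

theorem rotate_trans (R S : E3 ≃ₗᵢ[ℝ] E3) (x : S2) :
    rotate (R.trans S) x = rotate S (rotate R x) := rfl

theorem rotate_symm_rotate (R : E3 ≃ₗᵢ[ℝ] E3) (x : S2) : rotate R.symm (rotate R x) = x :=
  Subtype.ext (R.symm_apply_apply _)

theorem rotate_rotate_symm (R : E3 ≃ₗᵢ[ℝ] E3) (x : S2) : rotate R (rotate R.symm x) = x :=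
  Subtype.ext (R.apply_symm_apply _)

theorem dot_rotate_left (R : E3 ≃ₗᵢ[ℝ] E3) (x y : S2) :
    dot (rotate R x) y = dot x (rotate R.symm y) := by
  rw [← dot_rotate R x, rotate_rotate_symm]

theorem continuous_rotate (R : E3 ≃ₗᵢ[ℝ] E3) : Continuous (rotate R) := by
  unfold rotate
  exact Continuous.subtype_mk (R.continuous.comp continuous_subtype_val) _

theorem det_eq_one_or_neg_one (R : E3 ≃ₗᵢ[ℝ] E3) :
    LinearMap.det (R.toLinearEquiv : E3 →ₗ[ℝ] E3) = 1 ∨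
      LinearMap.det (R.toLinearEquiv : E3 →ₗ[ℝ] E3) = -1 := by
  have h1 := R.toLinearIsometry.normDet_eq_one
  rw [LinearMap.normDet_eq_abs_det] at h1
  exact eq_or_eq_neg_of_abs_eq h1

/-- Change of sign of the `i`-th coordinate. -/
def flip (i : Fin 3) : E3 ≃ₗᵢ[ℝ] E3 :=
  LinearIsometryEquiv.piLpCongrRight 2
    fun k => if k = i then LinearIsometryEquiv.neg ℝ else LinearIsometryEquiv.refl ℝ ℝ

theorem flip_apply (i k : Fin 3) (x : E3) : flip i x k = if k = i then -x k else x k := by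
  simp only [flip, LinearIsometryEquiv.piLpCongrRight_apply]
  split_ifs <;> simp

theorem det_flip (i : Fin 3) : LinearMap.det ((flip i).toLinearEquiv : E3 →ₗ[ℝ] E3) = -1 := by
  rw [← LinearMap.det_toMatrix (EuclideanSpace.basisFun (Fin 3) ℝ).toBasis, Matrix.det_fin_three]
  simp [LinearMap.toMatrix_apply, flip_apply]
  fin_cases i <;> simp

/-- The north pole. -/
def pole : S2 := ⟨EuclideanSpace.single 2 1, by simp⟩

/-- The point `(√(1 - t²), 0, t)`. -/
def meridian (t : ℝ) (ht : |t| ≤ 1) : S2 :=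
  ⟨!₂[√(1 - t ^ 2), 0, t], by
    have h : 0 ≤ 1 - t ^ 2 := by nlinarith [abs_le.1 ht, sq_abs t, abs_nonneg t]
    rw [mem_sphere_zero_iff_norm, EuclideanSpace.norm_eq, Fin.sum_univ_three]
    simp [Real.sq_sqrt h]⟩

theorem dot_pole (x : S2) : dot x pole = (x : E3) 2 := by
  simp [dot_eq_sum, pole]

theorem dot_meridian (t : ℝ) (ht : |t| ≤ 1) (u : S2) :
    dot (meridian t ht) u = √(1 - t ^ 2) * (u : E3) 0 + t * (u : E3) 2 := by
  simp [dot_eq_sum, Fin.sum_univ_three, meridian]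

/-- Two reflections suffice: one carries `y` to the pole, the next carries the image of `x` to the
meridian point of the same height. Equal heights put the pole on the second mirror. The determinant
is left uncontrolled. -/
theorem exists_isometry_canonical (x y : S2) :
    ∃ R : E3 ≃ₗᵢ[ℝ] E3, rotate R y = pole ∧
      rotate R x = meridian (dot x y) (abs_dot_le_one x y) := by
  set R₁ : E3 ≃ₗᵢ[ℝ] E3 := (ℝ ∙ ((y : E3) - pole))ᗮ.reflection
  have h1 : rotate R₁ y = pole :=
    Subtype.ext (Submodule.reflection_sub (by rw [norm_coe_S2, norm_coe_S2]))
  set m := meridian (dot x y) (abs_dot_le_one x y) with hm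
  set x₁ := rotate R₁ x
  have hx₁ : (x₁ : E3) 2 = dot x y := by rw [← dot_pole, ← h1, dot_rotate]
  have hm2 : (m : E3) 2 = dot x y := by simp [hm, meridian]
  set R₂ : E3 ≃ₗᵢ[ℝ] E3 := (ℝ ∙ ((x₁ : E3) - m))ᗮ.reflection
  have h2 : rotate R₂ x₁ = m :=
    Subtype.ext (Submodule.reflection_sub (by rw [norm_coe_S2, norm_coe_S2]))
  have h3 : rotate R₂ pole = pole := by
    apply Subtype.ext
    apply Submodule.reflection_mem_subspace_eq_self
    rw [Submodule.mem_orthogonal_singleton_iff_inner_left, inner_sub_right]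
    have e (z : S2) : inner ℝ (pole : E3) (z : E3) = (z : E3) 2 := by
      rw [← dot_pole, dot_comm]; rfl
    rw [e, e, hx₁, hm2, sub_self]
  exact ⟨R₁.trans R₂, by rw [rotate_trans, h1, h3], by rw [rotate_trans, h2]⟩

/-- `SO(3)` acts transitively on pairs of points at a given distance. -/
theorem exists_rotation {x y x' y' : S2} (h : dot x y = dot x' y') :
    ∃ R : E3 ≃ₗᵢ[ℝ] E3, LinearMap.det (R.toLinearEquiv : E3 →ₗ[ℝ] E3) = 1 ∧
      rotate R x = x' ∧ rotate R y = y' := by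
  obtain ⟨R, hy, hx⟩ := exists_isometry_canonical x y
  obtain ⟨S, hy', hx'⟩ := exists_isometry_canonical x' y'
  have hmm : meridian (dot x y) (abs_dot_le_one x y) =
      meridian (dot x' y') (abs_dot_le_one x' y') := by
    congr 1
  have det_trans (A B : E3 ≃ₗᵢ[ℝ] E3) :
      LinearMap.det ((A.trans B).toLinearEquiv : E3 →ₗ[ℝ] E3) =
        LinearMap.det (B.toLinearEquiv : E3 →ₗ[ℝ] E3) *
          LinearMap.det (A.toLinearEquiv : E3 →ₗ[ℝ] E3) := by
    rw [← LinearMap.det_comp]; rfl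
  -- `flip 1` fixes the plane of the canonical pair, so inserting it corrects a determinant `-1`
  -- without moving the points.
  have f1 : rotate (flip 1) pole = pole := by
    apply Subtype.ext
    ext k
    rw [rotate, flip_apply]
    fin_cases k <;> simp [pole]
  have f2 (t : ℝ) (ht : |t| ≤ 1) : rotate (flip 1) (meridian t ht) = meridian t ht := by
    apply Subtype.ext
    ext k
    rw [rotate, flip_apply]
    fin_cases k <;> simp [meridian]
  have hSx : rotate S.symm (meridian (dot x y) (abs_dot_le_one x y)) = x' := by
    rw [hmm, ← hx', rotate_symm_rotate]
  have hSy : rotate S.symm pole = y' := by rw [← hy', rotate_symm_rotate]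
  rcases det_eq_one_or_neg_one (R.trans S.symm) with hd | hd
  · exact ⟨R.trans S.symm, hd, by rw [rotate_trans, hx, hSx], by rw [rotate_trans, hy, hSy]⟩
  · refine ⟨(R.trans (flip 1)).trans S.symm, ?_, ?_, ?_⟩
    · rw [det_trans] at hd
      rw [det_trans, det_trans, det_flip]
      linarith
    · rw [rotate_trans, rotate_trans, hx, f2, hSx]
    · rw [rotate_trans, rotate_trans, hy, f1, hSy]

end Rotations

/-! ### Surface measure: invariance and moments of the height. -/

section Area

instance : IsFiniteMeasure area := inferInstanceAs (IsFiniteMeasure (volume : Measure E3).toSphere)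

-- `toSphere` measures a set through the volume of the cone over it; cones commute with linear
-- isometries, which preserve volume.
open scoped Pointwise in
theorem measurePreserving_rotate (R : E3 ≃ₗᵢ[ℝ] E3) : MeasurePreserving (rotate R) area area := by
  refine ⟨(continuous_rotate R).measurable, Measure.ext fun s hs => ?_⟩
  rw [Measure.map_apply (continuous_rotate R).measurable hs, area, Measure.toSphere_apply' _ hs,
    Measure.toSphere_apply' _ ((continuous_rotate R).measurable hs)]
  congr 1
  have : Set.Ioo (0 : ℝ) 1 • ((↑) '' (rotate R ⁻¹' s) : Set E3) =
      R ⁻¹' (Set.Ioo (0 : ℝ) 1 • ((↑) '' s : Set E3)) := by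
    ext v
    simp only [Set.mem_smul, Set.mem_image, Set.mem_preimage, exists_exists_and_eq_and]
    constructor
    · rintro ⟨r, hr, x, hx, rfl⟩
      exact ⟨r, hr, rotate R x, hx, by simp [rotate]⟩
    · rintro ⟨r, hr, x, hx, hv⟩
      refine ⟨r, hr, rotate R.symm x, by rwa [rotate_rotate_symm], ?_⟩
      apply R.injective
      rw [map_smul, ← hv]
      simp [rotate]
  rw [this]
  exact R.measurePreserving.measure_preimage_equiv (f := R.toMeasurableEquiv) _

theorem integral_comp_rotate (R : E3 ≃ₗᵢ[ℝ] E3) (f : S2 → ℝ) :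
    ∫ u, f (rotate R u) ∂area = ∫ u, f u ∂area := by
  let e : S2 ≃ᵐ S2 :=
    { toFun := rotate R, invFun := rotate R.symm, left_inv := rotate_symm_rotate R,
      right_inv := rotate_rotate_symm R, measurable_toFun := (continuous_rotate R).measurable,
      measurable_invFun := (continuous_rotate R.symm).measurable }
  exact (measurePreserving_rotate R).integral_comp e.measurableEmbedding f

/-- The Gaussian moment `∫₀^∞ r^n exp(-r²) dr`. -/
theorem integral_Ioi_pow_mul_exp_neg_sq (n : ℕ) :
    ∫ r in Set.Ioi (0 : ℝ), r ^ n * Real.exp (-r ^ 2) = 1 / 2 * Real.Gamma ((n + 1) / 2) := by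
  have := integral_rpow_mul_exp_neg_rpow (p := 2) (q := n) (by norm_num)
    (by have : (0 : ℝ) ≤ n := by positivity
        linarith)
  rw [← this]
  refine setIntegral_congr_fun measurableSet_Ioi fun r _ => ?_
  simp only [Real.rpow_natCast, Real.rpow_ofNat]

theorem integral_pow_mul_exp_neg_sq (m : ℕ) :
    ∫ r : ℝ, r ^ (2 * m) * Real.exp (-r ^ 2) =
      2 * ∫ r in Set.Ioi (0 : ℝ), r ^ (2 * m) * Real.exp (-r ^ 2) := by
  rw [← integral_comp_abs (f := fun r => r ^ (2 * m) * Real.exp (-r ^ 2))]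
  simp only [pow_mul, sq_abs]

theorem integral_E3_eq_polar (f : S2 → ℝ) (g : ℝ → ℝ) (F : E3 → ℝ)
    (hF : ∀ (u : S2) (r : ℝ), 0 < r → F (r • (u : E3)) = f u * g r) :
    ∫ x, F x = (∫ u, f u ∂area) * ∫ r in Set.Ioi (0 : ℝ), r ^ 2 * g r := by
  calc
    ∫ x, F x = ∫ x : ({0}ᶜ : Set E3), F x ∂((volume : Measure E3).comap (↑)) := by
      rw [integral_subtype_comap (measurableSet_singleton _).compl F, restrict_compl_singleton]
    _ = ∫ p : S2 × Set.Ioi (0 : ℝ), f p.1 * g p.2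
          ∂((volume : Measure E3).toSphere.prod (.volumeIoiPow (Module.finrank ℝ E3 - 1))) := by
      rw [← (volume : Measure E3).measurePreserving_homeomorphUnitSphereProd.integral_comp
        (Homeomorph.measurableEmbedding _)]
      refine integral_congr_ae (Filter.Eventually.of_forall fun x => ?_)
      have h := hF (homeomorphUnitSphereProd E3 x).1 (homeomorphUnitSphereProd E3 x).2
        (homeomorphUnitSphereProd E3 x).2.2
      have e : (x : E3) = ((homeomorphUnitSphereProd E3 x).2 : ℝ) •
          ((homeomorphUnitSphereProd E3 x).1 : E3) := by
        rw [← homeomorphUnitSphereProd_symm_apply_coe, Homeomorph.symm_apply_apply]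
      rw [← e] at h
      exact h
    _ = (∫ u, f u ∂area) *
          ∫ r : Set.Ioi (0 : ℝ), g r ∂(.volumeIoiPow (Module.finrank ℝ E3 - 1)) :=
      integral_prod_mul f (fun r : Set.Ioi (0 : ℝ) => g r)
    _ = _ := by
      rw [finrank_euclideanSpace_fin]
      simp only [Measure.volumeIoiPow, ENNReal.ofReal]
      rw [integral_withDensity_eq_integral_smul (by fun_prop),
        integral_subtype_comap measurableSet_Ioi fun a => Real.toNNReal (a ^ (3 - 1)) • g a,
        setIntegral_congr_fun measurableSet_Ioi fun x hx => ?_]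
      rw [NNReal.smul_def, Real.coe_toNNReal _ (pow_nonneg (le_of_lt hx) _), smul_eq_mul]

/-- Integrate `x₃^{2m} exp(-|x|²)` over space both as a product of one-dimensional integrals and in
polar coordinates; the quotient of Gamma values reduces by `Γ(s+1) = sΓ(s)`. -/
theorem integral_area_pow_even (m : ℕ) :
    ∫ u : S2, (u : E3) 2 ^ (2 * m) ∂area = 4 * Real.pi / (2 * m + 1) := by
  have h1 := integral_E3_eq_polar (fun u => (u : E3) 2 ^ (2 * m))
    (fun r => r ^ (2 * m) * Real.exp (-r ^ 2))
    (fun x => x 2 ^ (2 * m) * Real.exp (-‖x‖ ^ 2)) (fun u r hr => by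
      rw [norm_smul, norm_coe_S2, mul_one, Real.norm_of_nonneg hr.le]
      simp [mul_pow]
      ring)
  let F : Fin 3 → ℝ → ℝ := fun i v => v ^ (if i = 2 then 2 * m else 2 * 0) * Real.exp (-v ^ 2)
  have h2 : ∫ x : E3, x 2 ^ (2 * m) * Real.exp (-‖x‖ ^ 2) = ∏ i, ∫ v, F i v := by
    rw [← integral_fintype_prod_volume_eq_prod,
      ← (EuclideanSpace.volume_preserving_symm_measurableEquiv_toLp (Fin 3)).integral_comp
        (MeasurableEquiv.measurableEmbedding _)]
    refine integral_congr_ae (Filter.Eventually.of_forall fun x => ?_)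
    simp only [F, Fin.prod_univ_three, EuclideanSpace.norm_sq_eq, Fin.sum_univ_three]
    simp [Real.exp_add]
    ring
  rw [h2, Fin.prod_univ_three] at h1
  have F0 : F 0 = fun v => v ^ (2 * 0) * Real.exp (-v ^ 2) := rfl
  have F1 : F 1 = fun v => v ^ (2 * 0) * Real.exp (-v ^ 2) := rfl
  have F2 : F 2 = fun v => v ^ (2 * m) * Real.exp (-v ^ 2) := rfl
  rw [F0, F1, F2, integral_pow_mul_exp_neg_sq,
    integral_pow_mul_exp_neg_sq, integral_Ioi_pow_mul_exp_neg_sq,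
    integral_Ioi_pow_mul_exp_neg_sq] at h1
  simp_rw [← mul_assoc, ← pow_add] at h1
  rw [integral_Ioi_pow_mul_exp_neg_sq] at h1
  have e : ((2 + 2 * m : ℕ) + 1 : ℝ) / 2 = ((2 * m : ℕ) + 1 : ℝ) / 2 + 1 := by push_cast; ring
  have hp : (0 : ℝ) < ((2 * m : ℕ) + 1 : ℝ) / 2 := by positivity
  have hG := Real.Gamma_pos_of_pos hp
  rw [e, Real.Gamma_add_one hp.ne'] at h1
  have hhalf : ((2 * 0 : ℕ) + 1 : ℝ) / 2 = 1 / 2 := by norm_num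
  rw [hhalf, Real.Gamma_one_half_eq] at h1
  have hs : √Real.pi * √Real.pi = Real.pi := Real.mul_self_sqrt Real.pi_pos.le
  have hm : (2 * (m : ℝ) + 1) ≠ 0 := by positivity
  push_cast at h1 hG
  rw [eq_div_iff hm]
  apply mul_right_cancel₀ hG.ne'
  linear_combination (-4) * h1 + 4 * Real.Gamma ((2 * m + 1) / 2) * hs

theorem integral_area_pow_odd (m : ℕ) (hm : Odd m) : ∫ u : S2, (u : E3) 2 ^ m ∂area = 0 := by
  have := integral_comp_rotate (flip 2) (fun u => (u : E3) 2 ^ m)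
  have e (u : S2) : (rotate (flip 2) u : E3) 2 = -(u : E3) 2 := by
    rw [rotate, flip_apply, if_pos rfl]
  simp only [e, hm.neg_pow, integral_neg] at this
  linarith

end Area

/-! ### Legendre integrals and orthogonality on the sphere. -/

section LegendreIntegrals

open Polynomial

/-- By Rodrigues' formula the integrand is the derivative of a polynomial still divisible by `X² -
1`, which vanishes at both endpoints. -/
theorem intervalIntegral_legendre_succ (n : ℕ) :
    ∫ t in (-1 : ℝ)..1, (legendre (n + 1)).eval t = 0 := by
  set E : ℝ[X] := derivative^[n] ((X ^ 2 - 1 : ℝ[X]) ^ (n + 1)) with hE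
  have hdvd : (X ^ 2 - 1 : ℝ[X]) ∣ E := by
    have := pow_sub_dvd_iterate_derivative_of_pow_dvd (p := (X ^ 2 - 1 : ℝ[X]) ^ (n + 1))
      (q := (X ^ 2 - 1 : ℝ[X])) (n := n + 1) n dvd_rfl
    simpa using this
  obtain ⟨r, hr⟩ := hdvd
  have hleg : legendre (n + 1) = C (((2 : ℝ) ^ (n + 1) * ((n + 1) ! : ℝ))⁻¹) * derivative E := by
    rw [legendre, hE, ← Function.iterate_succ_apply' (f := derivative)]
  simp_rw [hleg, eval_mul, eval_C]
  rw [intervalIntegral.integral_const_mul,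
    intervalIntegral.integral_eq_sub_of_hasDerivAt (f := fun t => E.eval t)
      (fun t _ => E.hasDerivAt t) ((derivative E).continuous.intervalIntegrable _ _), hr]
  simp

theorem continuous_coord (i : Fin 3) : Continuous fun u : S2 => (u : E3) i := by fun_prop

theorem integrable_of_continuous {f : S2 → ℝ} (hf : Continuous f) : Integrable f area := by
  obtain ⟨C, hC⟩ := isCompact_univ.exists_bound_of_continuousOn hf.continuousOn
  exact Integrable.of_bound hf.measurable.aestronglyMeasurable C
    (Filter.Eventually.of_forall fun u => hC u (Set.mem_univ u))

/-- Archimedes' formula for polynomials of the height. -/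
theorem integral_area_polynomial (p : ℝ[X]) :
    ∫ u : S2, p.eval ((u : E3) 2) ∂area = 2 * Real.pi * ∫ t in (-1 : ℝ)..1, p.eval t := by
  have hm (n : ℕ) : ∫ u : S2, (u : E3) 2 ^ n ∂area =
      2 * Real.pi * ∫ t in (-1 : ℝ)..1, t ^ n := by
    rw [integral_pow]
    rcases Nat.even_or_odd' n with ⟨m, rfl | rfl⟩
    · rw [integral_area_pow_even, (show Odd (2 * m + 1) from ⟨m, rfl⟩).neg_one_pow]
      push_cast
      ring
    · rw [integral_area_pow_odd _ ⟨m, rfl⟩, show 2 * m + 1 + 1 = 2 * (m + 1) by ring, pow_mul (-1 : ℝ)]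
      simp
  have hI (n : ℕ) : Integrable (fun u : S2 => (u : E3) 2 ^ n) area :=
    integrable_of_continuous ((continuous_coord 2).pow n)
  simp_rw [eval_eq_sum_range]
  rw [integral_finsetSum _ fun i _ => (hI i).const_mul _,
    intervalIntegral.integral_finsetSum fun i _ =>
      ((continuous_pow i).intervalIntegrable _ _).const_mul _, Finset.mul_sum]
  refine Finset.sum_congr rfl fun i _ => ?_
  rw [integral_const_mul, intervalIntegral.integral_const_mul, hm]
  ring

theorem continuous_dot_left (y : S2) : Continuous fun u : S2 => dot u y := by
  unfold dot; fun_prop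

theorem integral_comp_dot (f : ℝ → ℝ) (y : S2) :
    ∫ u, f (dot u y) ∂area = ∫ u : S2, f ((u : E3) 2) ∂area := by
  obtain ⟨R, hR, _⟩ := exists_isometry_canonical y y
  rw [← integral_comp_rotate R (fun u => f ((u : E3) 2))]
  refine integral_congr_ae (Filter.Eventually.of_forall fun u => ?_)
  simp only
  rw [← dot_pole, ← hR, dot_rotate]

theorem integral_legendreP (n : ℕ) (y : S2) :
    ∫ u, legendreP n (dot u y) ∂area = if n = 0 then 4 * Real.pi else 0 := by
  rw [integral_comp_dot]
  unfold legendreP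
  rw [integral_area_polynomial]
  split_ifs with h
  · subst h
    simp [legendre_zero]
    ring
  · obtain ⟨m, rfl⟩ := Nat.exists_eq_succ_of_ne_zero h
    rw [intervalIntegral_legendre_succ, mul_zero]

/-- After linearising the product only the constant term `P_0` has a nonzero integral, and its
coefficient is the squared `3j` symbol with third degree `0`. -/
theorem integral_legendreP_mul (k l : ℕ) (y : S2) :
    ∫ u, legendreP k (dot u y) * legendreP l (dot u y) ∂area =
      if k = l then 4 * Real.pi / (2 * l + 1) else 0 := by
  have hI (n : ℕ) : Integrable (fun u : S2 => legendreP n (dot u y)) area :=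
    integrable_of_continuous ((continuous_legendreP n).comp (continuous_dot_left y))
  simp_rw [fun t => legendreP_mul_legendreP k l t (k + l + 1) (by omega)]
  rw [integral_finsetSum _ fun i _ => (hI i).const_mul _]
  simp_rw [integral_const_mul, integral_legendreP]
  rw [Finset.sum_eq_single_of_mem 0 (by simp) (fun i _ hi => by rw [if_neg hi, mul_zero])]
  rw [if_pos rfl]
  split_ifs with h
  · subst h
    have := threeJSq_eq 0 0 k
    simp only [zero_add] at this
    rw [Nat.cast_zero, Nat.cast_zero, this, wignerSq, centralBinomZ_zero]
    have h' := centralBinomZ_pos (i := k) (by omega)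
    simp only [zero_add]
    push_cast
    field_simp
    ring
  · rw [threeJSq_eq_zero (by omega)]; ring

end LegendreIntegrals

/-! ### The commutative algebra of zonal kernels. -/

section Kernels

/-- A bounded measurable kernel on the sphere that depends only on the scalar product. -/
structure ZonalKernel (A : S2 → S2 → ℝ) : Prop where
  measurable : Measurable (Function.uncurry A)
  bounded : ∃ C, ∀ x y, |A x y| ≤ C
  zonal : ∀ x y x' y', dot x y = dot x' y' → A x y = A x' y'

/-- Composition of kernels. -/
def conv (A B : S2 → S2 → ℝ) (x y : S2) : ℝ := ∫ u, A x u * B u y ∂area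

theorem integrable_of_bounded {α : Type*} [MeasurableSpace α] {μ : Measure α} [IsFiniteMeasure μ]
    {f : α → ℝ} (hf : Measurable f) {C : ℝ} (hC : ∀ x, |f x| ≤ C) : Integrable f μ :=
  Integrable.of_bound hf.aestronglyMeasurable C (Filter.Eventually.of_forall hC)

namespace ZonalKernel

variable {A B D : S2 → S2 → ℝ}

theorem symm (hA : ZonalKernel A) (x y : S2) : A x y = A y x := hA.zonal _ _ _ _ (dot_comm x y)

theorem rotate (hA : ZonalKernel A) (R : E3 ≃ₗᵢ[ℝ] E3) (x y : S2) :
    A (rotate R x) (SphericalField.rotate R y) = A x y := hA.zonal _ _ _ _ (dot_rotate R x y)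

theorem measurable_right (hA : ZonalKernel A) (x : S2) : Measurable (A x) :=
  hA.measurable.comp measurable_prodMk_left

theorem measurable_left (hA : ZonalKernel A) (y : S2) : Measurable fun x => A x y :=
  hA.measurable.comp measurable_prodMk_right

theorem integrable_mul (hA : ZonalKernel A) (hB : ZonalKernel B) (x y : S2) :
    Integrable (fun u => A x u * B u y) area := by
  obtain ⟨C, hC⟩ := hA.bounded
  obtain ⟨C', hC'⟩ := hB.bounded
  refine integrable_of_bounded ((hA.measurable_right x).mul (hB.measurable_left y))
    (C := C * C') fun u => ?_
  rw [abs_mul]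
  exact mul_le_mul (hC _ _) (hC' _ _) (abs_nonneg _) ((abs_nonneg _).trans (hC x u))

theorem conv (hA : ZonalKernel A) (hB : ZonalKernel B) : ZonalKernel (conv A B) where
  measurable := by
    have : StronglyMeasurable fun p : (S2 × S2) × S2 => A p.1.1 p.2 * B p.2 p.1.2 :=
      ((hA.measurable.comp (by fun_prop : Measurable fun p : (S2 × S2) × S2 => (p.1.1, p.2))).mul
        (hB.measurable.comp
          (by fun_prop : Measurable fun p : (S2 × S2) × S2 => (p.2, p.1.2)))).stronglyMeasurable
    exact (this.integral_prod_right' (ν := area)).measurable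
  bounded := by
    obtain ⟨C, hC⟩ := hA.bounded
    obtain ⟨C', hC'⟩ := hB.bounded
    refine ⟨C * C' * area.real Set.univ, fun x y => ?_⟩
    rw [← Real.norm_eq_abs, SphericalField.conv]
    refine norm_integral_le_of_norm_le_const (Filter.Eventually.of_forall fun u => ?_)
    rw [Real.norm_eq_abs, abs_mul]
    exact mul_le_mul (hC _ _) (hC' _ _) (abs_nonneg _) ((abs_nonneg _).trans (hC x u))
  zonal := by
    intro x y x' y' h
    obtain ⟨R, _, hx, hy⟩ := exists_rotation h
    unfold SphericalField.conv
    rw [← integral_comp_rotate R (fun u => A x' u * B u y')]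
    simp_rw [← hx, ← hy, hA.rotate, hB.rotate]

/-- The Gelfand trick: the composition is zonal, hence symmetric, and transposing a composition of
symmetric kernels reverses the factors. -/
theorem conv_comm (hA : ZonalKernel A) (hB : ZonalKernel B) :
    SphericalField.conv A B = SphericalField.conv B A := by
  funext x y
  rw [(hA.conv hB).symm]
  unfold SphericalField.conv
  refine integral_congr_ae (Filter.Eventually.of_forall fun u => ?_)
  simp only
  rw [hA.symm, hB.symm, mul_comm]

theorem conv_assoc (hA : ZonalKernel A) (hB : ZonalKernel B) (hD : ZonalKernel D) :
    SphericalField.conv (SphericalField.conv A B) D =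
      SphericalField.conv A (SphericalField.conv B D) := by
  funext x y
  unfold SphericalField.conv
  simp_rw [← integral_mul_const, ← integral_const_mul]
  rw [integral_integral_swap]
  · simp_rw [mul_assoc]
  · obtain ⟨C, hC⟩ := hA.bounded
    obtain ⟨C', hC'⟩ := hB.bounded
    obtain ⟨C'', hC''⟩ := hD.bounded
    refine integrable_of_bounded (μ := area.prod area) (C := C * C' * C'') ?_ fun p => ?_
    · have h1 : Measurable fun p : S2 × S2 => A x p.2 :=
        (hA.measurable_right x).comp measurable_snd
      have h2 : Measurable fun p : S2 × S2 => B p.2 p.1 := hB.measurable.comp measurable_swap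
      have h3 : Measurable fun p : S2 × S2 => D p.1 y := (hD.measurable_left y).comp measurable_fst
      exact (h1.mul h2).mul h3
    · simp only [Function.uncurry, abs_mul]
      have h0 := (abs_nonneg _).trans (hC x x)
      have h0' := (abs_nonneg _).trans (hC' x x)
      exact mul_le_mul (mul_le_mul (hC _ _) (hC' _ _) (abs_nonneg _) h0) (hC'' _ _) (abs_nonneg _)
        (mul_nonneg h0 h0')

theorem of_continuous {f : ℝ → ℝ} (hf : Continuous f) : ZonalKernel fun x y => f (dot x y) where
  measurable := (hf.comp continuous_dot).measurable
  bounded := by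
    obtain ⟨C, hC⟩ := isCompact_Icc.exists_bound_of_continuousOn (hf.continuousOn (s := Set.Icc (-1) 1))
    exact ⟨C, fun x y => hC _ (dot_mem_Icc x y)⟩
  zonal := fun x y x' y' h => by simp only [h]

end ZonalKernel

-- Convolution with a zonal kernel does not raise the degree. In canonical position, with `t =
-- ⟨x,y⟩`, one has `⟨x,u⟩ = √(1-t²) u₀ + t u₂`; odd powers of the root integrate to zero under `u₀ ↦
-- -u₀`, which fixes the pole, and even powers are polynomial in `t`.
open Polynomial in
theorem exists_polynomial_conv_pow {A : S2 → S2 → ℝ} (hA : ZonalKernel A) (n : ℕ) :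
    ∃ q : ℝ[X], q.natDegree ≤ n ∧
      ∀ x y, conv (fun x y => dot x y ^ n) A x y = q.eval (dot x y) := by
  set c : ℕ → ℝ := fun i => ∫ u : S2, (u : E3) 0 ^ i * (u : E3) 2 ^ (n - i) * A u pole ∂area with hc
  have hodd (i : ℕ) (hi : Odd i) : c i = 0 := by
    have h := integral_comp_rotate (flip 0)
      (fun u : S2 => (u : E3) 0 ^ i * (u : E3) 2 ^ (n - i) * A u pole)
    have f1 : rotate (flip 0) pole = pole := by
      apply Subtype.ext
      ext k
      rw [rotate, flip_apply]
      fin_cases k <;> simp [pole]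
    have f2 (u : S2) : A (rotate (flip 0) u) pole = A u pole := by
      nth_rw 1 [← f1]; exact hA.rotate _ _ _
    have f3 (u : S2) : (rotate (flip 0) u : E3) 0 = -(u : E3) 0 := by
      rw [rotate, flip_apply, if_pos rfl]
    have f4 (u : S2) : (rotate (flip 0) u : E3) 2 = (u : E3) 2 := by
      rw [rotate, flip_apply, if_neg (by decide)]
    simp only [f2, f3, f4, hi.neg_pow, neg_mul, integral_neg] at h
    simp only [hc]
    linarith
  refine ⟨∑ i ∈ Finset.range (n + 1), if Even i then
    C (n.choose i * c i) * ((1 - X ^ 2) ^ (i / 2) * X ^ (n - i)) else 0, ?_, fun x y => ?_⟩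
  · refine natDegree_sum_le_of_forall_le _ _ fun i hi => ?_
    split_ifs with h
    · refine (natDegree_C_mul_le _ _).trans (natDegree_mul_le.trans ?_)
      have h1 : ((1 - X ^ 2 : ℝ[X]) ^ (i / 2)).natDegree ≤ i / 2 * 2 :=
        natDegree_pow_le_of_le _ (by compute_degree)
      have := Finset.mem_range.1 hi
      rw [natDegree_X_pow]
      omega
    · simp
  · obtain ⟨R, hy, hx⟩ := exists_isometry_canonical x y
    have hK : ZonalKernel (fun x y => dot x y ^ n) := .of_continuous (continuous_pow n)
    rw [← (hK.conv hA).rotate R, hx, hy, eval_finsetSum]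
    unfold conv
    simp_rw [dot_meridian, add_pow, Finset.sum_mul]
    have hAm := hA.measurable_left pole
    obtain ⟨M, hM⟩ := hA.bounded
    have hint (i j : ℕ) : Integrable (fun u : S2 => (u : E3) 0 ^ i * (u : E3) 2 ^ j * A u pole)
        area := by
      refine Integrable.mul_bdd (c := M) (integrable_of_continuous ?_) hAm.aestronglyMeasurable
        (Filter.Eventually.of_forall fun u => hM u pole)
      exact ((continuous_coord 0).pow i).mul ((continuous_coord 2).pow j)
    have e (i : ℕ) : ∀ u : S2, (√(1 - dot x y ^ 2) * (u : E3) 0) ^ i * (dot x y * (u : E3) 2) ^ (n - i) *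
        (n.choose i : ℝ) * A u pole = (√(1 - dot x y ^ 2) ^ i * dot x y ^ (n - i) * n.choose i) *
          ((u : E3) 0 ^ i * (u : E3) 2 ^ (n - i) * A u pole) := fun u => by
      rw [mul_pow, mul_pow]; ring
    simp_rw [e]
    rw [integral_finsetSum _ fun i _ => (hint i (n - i)).const_mul _]
    refine Finset.sum_congr rfl fun i _ => ?_
    rw [integral_const_mul]
    change _ * c i = _
    split_ifs with h
    · obtain ⟨k, rfl⟩ := h
      have h0 : 0 ≤ 1 - dot x y ^ 2 := by
        have := (sq_le_one_iff_abs_le_one _).2 (abs_dot_le_one x y)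
        linarith
      have h1 : √(1 - dot x y ^ 2) ^ (k + k) = (1 - dot x y ^ 2) ^ k := by
        rw [← two_mul, pow_mul, Real.sq_sqrt h0]
      rw [h1, show (k + k) / 2 = k by omega]
      simp
      ring
    · rw [hodd i (Nat.not_even_iff_odd.1 h)]
      simp

open Polynomial in
theorem exists_polynomial_conv {A : S2 → S2 → ℝ} (hA : ZonalKernel A) (p : ℝ[X]) (n : ℕ)
    (hp : p.natDegree ≤ n) :
    ∃ q : ℝ[X], q.natDegree ≤ n ∧
      ∀ x y, conv (fun x y => p.eval (dot x y)) A x y = q.eval (dot x y) := by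
  choose q hq hq' using exists_polynomial_conv_pow hA
  refine ⟨∑ i ∈ Finset.range (n + 1), C (p.coeff i) * q i, ?_, fun x y => ?_⟩
  · refine natDegree_sum_le_of_forall_le _ _ fun i hi => ?_
    exact (natDegree_C_mul_le _ _).trans ((hq i).trans (Nat.lt_succ_iff.1 (Finset.mem_range.1 hi)))
  · rw [eval_finsetSum]
    unfold conv
    simp_rw [eval_eq_sum_range' (Nat.lt_succ_of_le hp), Finset.sum_mul, mul_assoc]
    rw [integral_finsetSum _ fun i _ => ((ZonalKernel.of_continuous
      (continuous_pow i)).integrable_mul hA x y).const_mul _]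
    refine Finset.sum_congr rfl fun i _ => ?_
    rw [integral_const_mul, eval_mul, eval_C, ← hq']
    rfl

end Kernels

/-! ### Reproducing property and the Funk–Hecke formula. -/

section Reproducing

/-- The reproducing kernel `(2ℓ+1)/(4π) P_ℓ(⟨x, y⟩)` of the harmonics of degree `ℓ`. -/
def legK (l : ℕ) (x y : S2) : ℝ := (2 * (l : ℝ) + 1) / (4 * Real.pi) * legendreP l (dot x y)

theorem zonalKernel_legK (l : ℕ) : ZonalKernel (legK l) :=
  .of_continuous (f := fun t => (2 * (l : ℝ) + 1) / (4 * Real.pi) * legendreP l t)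
    (continuous_const.mul (continuous_legendreP l))

theorem legK_self (l : ℕ) (x : S2) : legK l x x = (2 * (l : ℝ) + 1) / (4 * Real.pi) := by
  rw [legK, dot_self, legendreP_one_right, mul_one]

theorem legK_self_pos (l : ℕ) (x : S2) : 0 < legK l x x := by
  rw [legK_self]; have := Real.pi_pos; positivity

theorem conv_legK_legK_self (k l : ℕ) (x : S2) :
    conv (legK k) (legK l) x x = if k = l then legK l x x else 0 := by
  have e : ∀ u, legK k x u * legK l u x = ((2 * (k : ℝ) + 1) / (4 * Real.pi) *
      ((2 * (l : ℝ) + 1) / (4 * Real.pi))) * (legendreP k (dot u x) * legendreP l (dot u x)) :=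
    fun u => by rw [(zonalKernel_legK k).symm, legK, legK]; ring
  rw [conv]
  simp_rw [e]
  rw [integral_const_mul, integral_legendreP_mul, legK_self]
  split_ifs with h
  · subst h
    have := Real.pi_ne_zero
    have : (2 * (k : ℝ) + 1) ≠ 0 := by positivity
    field_simp
  · rw [mul_zero]

theorem exists_conv_legK_expansion {A : S2 → S2 → ℝ} (hA : ZonalKernel A) (l : ℕ) :
    ∃ d : ℕ → ℝ, ∀ x y, conv (legK l) A x y = ∑ k ∈ Finset.range (l + 1), d k * legK k x y := by
  obtain ⟨q, hq, hq'⟩ := exists_polynomial_conv hA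
    (Polynomial.C ((2 * (l : ℝ) + 1) / (4 * Real.pi)) * legendre l) l
    ((Polynomial.natDegree_C_mul_le _ _).trans (natDegree_legendre_le l))
  obtain ⟨c, hc⟩ := exists_legendre_expansion q l hq
  refine ⟨fun k => c k / ((2 * (k : ℝ) + 1) / (4 * Real.pi)), fun x y => ?_⟩
  have e : legK l = fun x y =>
      (Polynomial.C ((2 * (l : ℝ) + 1) / (4 * Real.pi)) * legendre l).eval (dot x y) := by
    funext x y
    rw [Polynomial.eval_mul, Polynomial.eval_C, legK, legendreP]
  rw [e, hq', hc]
  refine Finset.sum_congr rfl fun k _ => ?_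
  rw [legK, ← mul_assoc, div_mul_cancel₀]
  have := Real.pi_pos
  positivity

theorem conv_sum_legK {A B : S2 → S2 → ℝ} (hB : ZonalKernel B) (d : ℕ → ℝ) (s : Finset ℕ)
    (hA : ∀ x y, A x y = ∑ k ∈ s, d k * legK k x y) (x y : S2) :
    conv A B x y = ∑ k ∈ s, d k * conv (legK k) B x y := by
  unfold conv
  simp_rw [hA, Finset.sum_mul, mul_assoc]
  rw [integral_finsetSum _ fun i _ => ((zonalKernel_legK i).integrable_mul hB x y).const_mul _]
  simp_rw [integral_const_mul]

theorem conv_zero_right (A : S2 → S2 → ℝ) : conv A (fun _ _ => 0) = fun _ _ => 0 := by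
  funext x y; simp [conv]

/-- By strong induction on `l`. A composition `K_k * K_l` lies in the span of `K_0, …, K_k`;
composing with `K_m` isolates one coefficient, and commutativity and associativity regroup the
product so that the induction or orthogonality at the pole kills it. The top coefficient of `K_l *
K_l` is read off the diagonal. -/
theorem conv_legK_legK_aux (l : ℕ) :
    (∀ k < l, conv (legK k) (legK l) = fun _ _ => 0) ∧ conv (legK l) (legK l) = legK l := by
  induction l using Nat.strong_induction_on with
  | _ l ih =>
  have orth : ∀ k < l, ∀ m < l, k ≠ m → conv (legK k) (legK m) = fun _ _ => 0 := by
    intro k hk m hm hkm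
    rcases lt_or_gt_of_ne hkm with h | h
    · exact (ih m hm).1 k h
    · rw [(zonalKernel_legK k).conv_comm (zonalKernel_legK m)]
      exact (ih k hk).1 m h
  have h1 : ∀ k < l, conv (legK k) (legK l) = fun _ _ => 0 := by
    intro k hk
    obtain ⟨d, hd⟩ := exists_conv_legK_expansion (zonalKernel_legK l) k
    have hd0 : ∀ m ∈ Finset.range (k + 1), d m = 0 := by
      intro m hm
      have hm' := Finset.mem_range.1 hm
      have e1 := conv_sum_legK (zonalKernel_legK m) d _ hd pole pole
      rw [Finset.sum_eq_single_of_mem m hm (fun i hi him => by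
        rw [orth i (by have := Finset.mem_range.1 hi; omega) m (by omega) him, mul_zero]),
        (ih m (by omega)).2, (zonalKernel_legK k).conv_comm (zonalKernel_legK l),
        (zonalKernel_legK l).conv_assoc (zonalKernel_legK k) (zonalKernel_legK m)] at e1
      have e2 : conv (legK l) (conv (legK k) (legK m)) pole pole = 0 := by
        by_cases hkm : k = m
        · subst hkm
          rw [(ih k hk).2, conv_legK_legK_self, if_neg (by omega)]
        · rw [orth k hk m (by omega) hkm, conv_zero_right]
      rw [e2] at e1
      exact (mul_eq_zero.1 e1.symm).resolve_right (legK_self_pos m pole).ne'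
    funext x y
    rw [hd, Finset.sum_eq_zero fun m hm => by rw [hd0 m hm, zero_mul]]
  refine ⟨h1, ?_⟩
  have h2 : ∀ m < l, conv (legK l) (legK m) = fun _ _ => 0 := fun m hm => by
    rw [(zonalKernel_legK l).conv_comm (zonalKernel_legK m), h1 m hm]
  obtain ⟨d, hd⟩ := exists_conv_legK_expansion (zonalKernel_legK l) l
  have hd0 : ∀ m < l, d m = 0 := by
    intro m hm
    have e1 := conv_sum_legK (zonalKernel_legK m) d _ hd pole pole
    rw [Finset.sum_eq_single_of_mem m (Finset.mem_range.2 (by omega)) (fun i hi him => by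
        by_cases hil : i = l
        · rw [hil, h2 m hm, mul_zero]
        · rw [orth i (by have := Finset.mem_range.1 hi; omega) m (by omega) him, mul_zero]),
      (ih m hm).2, (zonalKernel_legK l).conv_assoc (zonalKernel_legK l) (zonalKernel_legK m),
      h2 m hm, conv_zero_right] at e1
    exact (mul_eq_zero.1 e1.symm).resolve_right (legK_self_pos m pole).ne'
  have hd1 : ∀ x y, conv (legK l) (legK l) x y = d l * legK l x y := fun x y => by
    rw [hd, Finset.sum_range_succ, Finset.sum_eq_zero fun m hm => by
      rw [hd0 m (Finset.mem_range.1 hm), zero_mul], zero_add]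
  have hdl := hd1 pole pole
  rw [conv_legK_legK_self, if_pos rfl] at hdl
  have : d l = 1 := by
    have h := legK_self_pos l pole
    apply mul_right_cancel₀ h.ne'
    linarith
  funext x y
  rw [hd1, this, one_mul]

/-- The reproducing property of the Legendre kernels. -/
theorem conv_legK_legK (k l : ℕ) (x y : S2) :
    conv (legK k) (legK l) x y = if k = l then legK l x y else 0 := by
  rcases lt_trichotomy k l with h | h | h
  · rw [(conv_legK_legK_aux l).1 k h, if_neg h.ne]
  · rw [h, (conv_legK_legK_aux l).2, if_pos rfl]
  · rw [(zonalKernel_legK k).conv_comm (zonalKernel_legK l), (conv_legK_legK_aux k).1 l h,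
      if_neg h.ne']

/-- The Funk–Hecke formula. -/
theorem conv_legK_eq {A : S2 → S2 → ℝ} (hA : ZonalKernel A) (l : ℕ) :
    ∃ c : ℝ, ∀ x y, conv (legK l) A x y = c * legK l x y := by
  obtain ⟨d, hd⟩ := exists_conv_legK_expansion hA l
  have hd0 : ∀ m < l, d m = 0 := by
    intro m hm
    -- Composing with `K_m` extracts `d m`; commuting `A` to the front brings `K_l` next to `K_m`,
    -- and their composition is zero.
    have e1 := conv_sum_legK (zonalKernel_legK m) d _ hd pole pole
    have h0 : conv (legK l) (legK m) = fun _ _ => 0 := by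
      funext x y; rw [conv_legK_legK, if_neg hm.ne']
    rw [Finset.sum_eq_single_of_mem m (Finset.mem_range.2 (by omega)) (fun i hi him => by
        rw [conv_legK_legK, if_neg him, mul_zero]),
      conv_legK_legK, if_pos rfl, (zonalKernel_legK l).conv_comm hA,
      hA.conv_assoc (zonalKernel_legK l) (zonalKernel_legK m), h0, conv_zero_right] at e1
    exact (mul_eq_zero.1 e1.symm).resolve_right (legK_self_pos m pole).ne'
  refine ⟨d l, fun x y => ?_⟩
  rw [hd, Finset.sum_range_succ, Finset.sum_eq_zero fun m hm => by
    rw [hd0 m (Finset.mem_range.1 hm), zero_mul], zero_add]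

end Reproducing

/-! ### Fubini for fields with bounded second moments. -/

section SecondOrderFields

variable {α β Ω : Type*} [MeasurableSpace α] [MeasurableSpace β] [MeasurableSpace Ω]

/-- A jointly measurable random field with uniformly bounded second moments. -/
structure L2Field (X : α → Ω → ℝ) (P : Measure Ω) : Prop where
  measurable : Measurable (Function.uncurry X)
  memLp : ∀ u, MemLp (X u) 2 P
  bounded : ∃ M, ∀ u, ∫ ω, X u ω ^ 2 ∂P ≤ M

namespace L2Field

variable {P : Measure Ω} {X : α → Ω → ℝ} {Y : β → Ω → ℝ}

theorem mul_left (hX : L2Field X P) {f : α → ℝ} (hf : Measurable f) {C : ℝ}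
    (hC : ∀ u, |f u| ≤ C) : L2Field (fun u ω => f u * X u ω) P where
  measurable := (hf.comp measurable_fst).mul hX.measurable
  memLp u := (hX.memLp u).const_mul _
  bounded := by
    obtain ⟨M, hM⟩ := hX.bounded
    refine ⟨C ^ 2 * M, fun u => ?_⟩
    simp_rw [mul_pow]
    rw [integral_const_mul]
    have h0 : 0 ≤ ∫ ω, X u ω ^ 2 ∂P := integral_nonneg fun ω => sq_nonneg _
    refine mul_le_mul ?_ (hM u) h0 (sq_nonneg _)
    rw [← sq_abs]
    exact pow_le_pow_left₀ (abs_nonneg _) (hC u) 2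

theorem const {Z : Ω → ℝ} (hZ : Measurable Z) (hZ2 : MemLp Z 2 P) :
    L2Field (fun (_ : β) ω => Z ω) P where
  measurable := hZ.comp measurable_snd
  memLp _ := hZ2
  bounded := ⟨_, fun _ => le_rfl⟩

theorem measurable_integral {μ : Measure α} [SFinite μ] (hX : L2Field X P) : Measurable fun ω => ∫ u, X u ω ∂μ :=
  (hX.measurable.stronglyMeasurable.integral_prod_left (μ := μ)).measurable

variable [IsFiniteMeasure P] {μ : Measure α} {ν : Measure β} [IsFiniteMeasure μ] [IsFiniteMeasure ν]

/-- The bound `|XY| ≤ (X² + Y²)/2` and the uniform second moments give the absolute integrability on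
which all exchanges of integrals rest. -/
theorem integrable_prod (hX : L2Field X P) (hY : L2Field Y P) :
    Integrable (fun p : (α × β) × Ω => X p.1.1 p.2 * Y p.1.2 p.2) ((μ.prod ν).prod P) := by
  have hm : Measurable fun p : (α × β) × Ω => X p.1.1 p.2 * Y p.1.2 p.2 :=
    (hX.measurable.comp (by fun_prop : Measurable fun p : (α × β) × Ω => (p.1.1, p.2))).mul
      (hY.measurable.comp (by fun_prop : Measurable fun p : (α × β) × Ω => (p.1.2, p.2)))
  rw [integrable_prod_iff hm.aestronglyMeasurable]
  refine ⟨Filter.Eventually.of_forall fun p => (hX.memLp p.1).integrable_mul (hY.memLp p.2), ?_⟩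
  obtain ⟨M, hM⟩ := hX.bounded
  obtain ⟨M', hM'⟩ := hY.bounded
  refine integrable_of_bounded (C := (M + M') / 2)
    (hm.stronglyMeasurable.norm.integral_prod_right' (ν := P)).measurable fun p => ?_
  rw [abs_of_nonneg (integral_nonneg fun ω => norm_nonneg _)]
  have i1 := (hX.memLp p.1).integrable_sq
  have i2 := (hY.memLp p.2).integrable_sq
  calc
    _ ≤ ∫ ω, (X p.1 ω ^ 2 + Y p.2 ω ^ 2) / 2 ∂P := by
      refine integral_mono ((hX.memLp p.1).integrable_mul (hY.memLp p.2)).norm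
        ((i1.add i2).div_const 2) fun ω => ?_
      simp only [Real.norm_eq_abs]
      rw [abs_le]
      constructor <;> nlinarith [sq_nonneg (X p.1 ω + Y p.2 ω), sq_nonneg (X p.1 ω - Y p.2 ω)]
    _ = (∫ ω, X p.1 ω ^ 2 ∂P + ∫ ω, Y p.2 ω ^ 2 ∂P) / 2 := by
      rw [integral_div, integral_add i1 i2]
    _ ≤ _ := by linarith [hM p.1, hM' p.2]

theorem integrable_integral_mul_integral (hX : L2Field X P) (hY : L2Field Y P) :
    Integrable (fun ω => (∫ u, X u ω ∂μ) * ∫ v, Y v ω ∂ν) P := by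
  refine (integrable_prod (μ := μ) (ν := ν) hX hY).integral_prod_right.congr
    (Filter.Eventually.of_forall fun ω => ?_)
  exact integral_prod_mul (fun u => X u ω) (fun v => Y v ω)

theorem integral_integral_mul_integral (hX : L2Field X P) (hY : L2Field Y P) :
    ∫ ω, (∫ u, X u ω ∂μ) * (∫ v, Y v ω ∂ν) ∂P =
      ∫ u, ∫ v, ∫ ω, X u ω * Y v ω ∂P ∂ν ∂μ := by
  have h := integrable_prod (μ := μ) (ν := ν) hX hY
  rw [← integral_prod (fun p : α × β => ∫ ω, X p.1 ω * Y p.2 ω ∂P) h.integral_prod_left,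
    integral_integral_swap (f := fun (p : α × β) ω => X p.1 ω * Y p.2 ω) h]
  refine integral_congr_ae (Filter.Eventually.of_forall fun ω => ?_)
  exact (integral_prod_mul (fun u => X u ω) (fun v => Y v ω)).symm

theorem memLp_integral (hX : L2Field X P) : MemLp (fun ω => ∫ u, X u ω ∂μ) 2 P := by
  rw [memLp_two_iff_integrable_sq hX.measurable_integral.aestronglyMeasurable]
  simpa only [sq] using hX.integrable_integral_mul_integral (μ := μ) (ν := μ) hX

theorem integral_mul_integral (hX : L2Field X P) {Z : Ω → ℝ} (hZ : Measurable Z)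
    (hZ2 : MemLp Z 2 P) :
    ∫ ω, (∫ u, X u ω ∂μ) * Z ω ∂P = ∫ u, ∫ ω, X u ω * Z ω ∂P ∂μ := by
  -- A single variable is a field over a one-point space with Dirac mass.
  have := hX.integral_integral_mul_integral (μ := μ) (ν := Measure.dirac ())
    (const (β := Unit) hZ hZ2)
  simpa using this

theorem integral_integral (hX : L2Field X P) :
    ∫ ω, ∫ u, X u ω ∂μ ∂P = ∫ u, ∫ ω, X u ω ∂P ∂μ := by
  simpa using hX.integral_mul_integral (μ := μ) (measurable_const (a := (1 : ℝ))) (memLp_const 1)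

theorem ae_integrable (hX : L2Field X P) : ∀ᵐ ω ∂P, Integrable (fun u => X u ω) μ := by
  have h := integrable_prod (μ := μ) (ν := Measure.dirac ()) hX
    (const (β := Unit) (measurable_const (a := (1 : ℝ))) (memLp_const 1))
  have := h.prod_left_ae
  filter_upwards [this] with ω hω
  have h2 := hω.integral_prod_left
  simpa using h2

end L2Field

end SecondOrderFields

/-! ### `L²` limits of centred Gaussian variables. -/

section GaussianLimits

variable {Ω : Type*} [MeasurableSpace Ω] {P : Measure Ω}

theorem charFun_map_eq_integral {X : Ω → ℝ} (hX : AEMeasurable X P) (t : ℝ) :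
    charFun (P.map X) t = ∫ ω, Complex.exp (t * X ω * Complex.I) ∂P := by
  rw [charFun_apply_real, integral_map hX (by fun_prop)]

/-- A centred Gaussian variable is determined by its second moment. -/
theorem charFun_of_centered {X : Ω → ℝ} (hX : HasGaussianLaw X P)
    (h0 : ∫ ω, X ω ∂P = 0) (t : ℝ) :
    charFun (P.map X) t = Complex.exp (-((∫ ω, X ω ^ 2 ∂P : ℝ) * t ^ 2 / 2)) := by
  have hv : Var[X; P] = ∫ ω, X ω ^ 2 ∂P := variance_of_integral_eq_zero hX.aemeasurable h0
  rw [hX.map_eq_gaussianReal, charFun_gaussianReal, h0, Real.coe_toNNReal _ (variance_nonneg _ _), hv]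
  congr 1
  simp

theorem hasGaussianLaw_of_charFun [IsProbabilityMeasure P] {X : Ω → ℝ} (hX : AEMeasurable X P) (v : ℝ) (hv : 0 ≤ v)
    (h : ∀ t : ℝ, charFun (P.map X) t = Complex.exp (-(v * t ^ 2 / 2))) : HasGaussianLaw X P := by
  have hp : IsProbabilityMeasure (P.map X) := P.isProbabilityMeasure_map hX
  have : P.map X = gaussianReal 0 v.toNNReal := by
    refine Measure.ext_of_charFun (funext fun t => ?_)
    rw [h, charFun_gaussianReal, Real.coe_toNNReal v hv]
    congr 1
    simp
  exact ⟨by rw [this]; infer_instance⟩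

/-- An `L²` limit of centred Gaussian variables is Gaussian. -/
theorem hasGaussianLaw_of_tendsto [IsProbabilityMeasure P] {s : ℕ → Lp ℝ 2 P} {z : Lp ℝ 2 P}
    (hs : ∀ n, HasGaussianLaw (s n) P) (h0 : ∀ n, ∫ ω, s n ω ∂P = 0)
    (hlim : Filter.Tendsto s Filter.atTop (nhds z)) : HasGaussianLaw z P := by
  have hsq (y : Lp ℝ 2 P) : ∫ ω, y ω ^ 2 ∂P = ‖y‖ ^ 2 := by
    rw [← real_inner_self_eq_norm_sq, L2.inner_def]
    simp [sq]
  have hz : AEMeasurable z P := (Lp.aestronglyMeasurable z).aemeasurable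
  refine hasGaussianLaw_of_charFun hz (‖z‖ ^ 2) (sq_nonneg _) fun t => ?_
  -- Along an almost surely convergent subsequence the characteristic functions converge by
  -- domination; explicitly they depend only on the `L²` norms, which converge too.
  obtain ⟨ns, hns, hae⟩ := (tendstoInMeasure_of_tendsto_Lp hlim).exists_seq_tendsto_ae
  have l1 : Filter.Tendsto (fun n => charFun (P.map (s (ns n))) t) Filter.atTop
      (nhds (charFun (P.map z) t)) := by
    simp_rw [charFun_map_eq_integral hz,
      charFun_map_eq_integral (Lp.aestronglyMeasurable (s _)).aemeasurable]
    refine tendsto_integral_of_dominated_convergence (fun _ => 1) (fun n => ?_)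
      (integrable_const _) (fun n => Filter.Eventually.of_forall fun ω => ?_) ?_
    · have := (Lp.aestronglyMeasurable (s (ns n))).aemeasurable
      exact (by fun_prop : AEMeasurable _ P).aestronglyMeasurable
    · rw [← Complex.ofReal_mul, Complex.norm_exp_ofReal_mul_I]
    · filter_upwards [hae] with ω hω
      exact (Complex.continuous_exp.tendsto _).comp
        ((((Complex.continuous_ofReal.tendsto _).comp hω).const_mul _).mul_const _)
  refine tendsto_nhds_unique l1 ?_
  have l2 : Filter.Tendsto (fun n => ‖s (ns n)‖) Filter.atTop (nhds ‖z‖) :=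
    (hlim.comp hns.tendsto_atTop).norm
  have l3 : Filter.Tendsto (fun n => Complex.exp (-(((‖s (ns n)‖ ^ 2 : ℝ) : ℂ) * t ^ 2 / 2)))
      Filter.atTop (nhds (Complex.exp (-(((‖z‖ ^ 2 : ℝ) : ℂ) * t ^ 2 / 2)))) := by
    have hc : Continuous fun r : ℝ => Complex.exp (-(((r ^ 2 : ℝ) : ℂ) * t ^ 2 / 2)) := by fun_prop
    exact (hc.tendsto _).comp l2
  refine l3.congr fun n => ?_
  rw [charFun_of_centered (hs _) (h0 _), hsq]

end GaussianLimits

/-! ### Integrals of a Gaussian field are Gaussian. -/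

section GaussianIntegrals

variable {α Ω : Type*} [MeasurableSpace α] [MeasurableSpace Ω] {P : Measure Ω}
  [IsProbabilityMeasure P] {μ : Measure α} [IsFiniteMeasure μ] {T : α → Ω → ℝ}

/-- By Fubini, whatever is orthogonal to every `T u` is orthogonal to the integral, which therefore
lies in the closed span of the `T u`. No path regularity or Riemann sums are needed. -/
theorem hasGaussianLaw_integral (hT : L2Field T P) (hG : IsGaussianProcess T P)
    (h0 : ∀ x, ∫ ω, T x ω ∂P = 0) {f : α → ℝ} (hf : Measurable f) {C : ℝ} (hC : ∀ u, |f u| ≤ C) :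
    HasGaussianLaw (fun ω => ∫ u, f u * T u ω ∂μ) P := by
  have hfT := hT.mul_left hf hC
  have hz := hfT.memLp_integral (μ := μ)
  set z : Lp ℝ 2 P := hz.toLp _ with hzdef
  set τ : α → Lp ℝ 2 P := fun u => (hT.memLp u).toLp _ with hτ
  set S : Submodule ℝ (Lp ℝ 2 P) := Submodule.span ℝ (Set.range τ) with hS
  have hmem : z ∈ S.topologicalClosure := by
    rw [← Submodule.orthogonal_orthogonal_eq_closure, Submodule.mem_orthogonal]
    intro w hw
    have hw' : ∀ u, ∫ ω, T u ω * w ω ∂P = 0 := by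
      intro u
      have := (Submodule.mem_orthogonal S w).1 hw (τ u)
        (Submodule.subset_span (Set.mem_range_self u))
      rw [L2.inner_def] at this
      rw [← this]
      refine integral_congr_ae ?_
      filter_upwards [(hT.memLp u).coeFn_toLp] with ω hω
      simp only [hτ]
      rw [hω]
      simp [mul_comm]
    rw [L2.inner_def]
    have e : ∫ ω, inner ℝ (w ω) (z ω) ∂P = ∫ ω, (∫ u, f u * T u ω ∂μ) * w ω ∂P := by
      refine integral_congr_ae ?_
      filter_upwards [hz.coeFn_toLp] with ω hω
      simp only [hzdef]
      rw [hω]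
      simp
    rw [e, hfT.integral_mul_integral (Lp.stronglyMeasurable w).measurable (Lp.memLp w)]
    simp_rw [mul_assoc, integral_const_mul, hw', mul_zero]
    simp
  obtain ⟨s, hs, hlim⟩ := mem_closure_iff_seq_limit.1 hmem
  have key : ∀ n, HasGaussianLaw (s n) P ∧ ∫ ω, s n ω ∂P = 0 := by
    intro n
    obtain ⟨c, hc⟩ := Finsupp.mem_span_range_iff_exists_finsupp.1 (hs n)
    have hae : (fun ω => ∑ u ∈ c.support, c u • T u ω) =ᵐ[P] s n := by
      rw [← hc, Finsupp.sum]
      have h1 := Lp.coeFn_finsetSum c.support fun u => c u • τ u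
      have h2 : ∀ᵐ ω ∂P, ∀ u ∈ c.support, (c u • τ u : Lp ℝ 2 P) ω = c u • T u ω := by
        rw [Filter.eventually_all_finset]
        intro u _
        filter_upwards [Lp.coeFn_smul (c u) (τ u), (hT.memLp u).coeFn_toLp] with ω h3 h4
        rw [h3, Pi.smul_apply, h4]
      filter_upwards [h1, h2] with ω h1 h2
      rw [h1, Finset.sum_apply]
      exact Finset.sum_congr rfl fun u hu => (h2 u hu).symm
    refine ⟨((hG.smul c).hasGaussianLaw_fun_sum (I := c.support)).congr hae, ?_⟩
    have hi (u : α) : Integrable (fun ω => c u • T u ω) P :=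
      ((hT.memLp u).integrable one_le_two).smul (c u)
    rw [← integral_congr_ae hae, integral_finsetSum _ fun u _ => hi u]
    simp_rw [integral_smul, h0, smul_zero, Finset.sum_const_zero]
  have := hasGaussianLaw_of_tendsto (fun n => (key n).1) (fun n => (key n).2) hlim
  exact this.congr hz.coeFn_toLp

/-- By Cramér–Wold: a linear combination of the integrals is, almost surely, one integral against
the combined weight. -/
theorem isGaussianProcess_integral {ι : Type*} (hT : L2Field T P) (hG : IsGaussianProcess T P)
    (h0 : ∀ x, ∫ ω, T x ω ∂P = 0) {f : ι → α → ℝ} (hf : ∀ i, Measurable (f i))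
    (hC : ∀ i, ∃ C, ∀ u, |f i u| ≤ C) :
    IsGaussianProcess (fun i ω => ∫ u, f i u * T u ω ∂μ) P where
  hasGaussianLaw I := by
    choose C hC using hC
    have hm : ∀ i, Measurable fun ω => ∫ u, f i u * T u ω ∂μ := fun i =>
      (hT.mul_left (hf i) (hC i)).measurable_integral
    have hmI : Measurable fun ω => I.restrict (fun i => ∫ u, f i u * T u ω ∂μ) :=
      measurable_pi_lambda _ fun i => hm i
    refine ⟨isGaussian_of_isGaussian_map fun L => ?_⟩
    rw [Measure.map_map (by fun_prop) hmI]
    classical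
    set c : I → ℝ := fun i => L (Pi.single i 1) with hc
    have hL : ∀ y : I → ℝ, L y = ∑ i, c i * y i := fun y => by
      conv_lhs => rw [pi_eq_sum_univ' y]
      rw [map_sum]
      refine Finset.sum_congr rfl fun i _ => ?_
      rw [map_smul, smul_eq_mul, mul_comm]
    have hg := hasGaussianLaw_integral (μ := μ) hT hG h0 (f := fun u => ∑ i : I, c i * f i u)
      (C := ∑ i : I, |c i| * C i)
      (Finset.measurable_sum _ fun i _ => (hf i).const_mul _) (fun u => by
        refine (Finset.abs_sum_le_sum_abs _ _).trans (Finset.sum_le_sum fun i _ => ?_)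
        rw [abs_mul]
        exact mul_le_mul_of_nonneg_left (hC i u) (abs_nonneg _))
    refine (hg.congr ?_).isGaussian_map
    have hint : ∀ᵐ ω ∂P, ∀ i : I, Integrable (fun u => f i u * T u ω) μ := by
      rw [Filter.eventually_all]
      exact fun i => (hT.mul_left (hf i) (hC i)).ae_integrable
    filter_upwards [hint] with ω hω
    simp only [Function.comp_apply, hL, Finset.sum_mul, mul_assoc]
    rw [integral_finsetSum _ fun i _ => (hω i).const_mul _]
    simp_rw [integral_const_mul]
    rfl

end GaussianIntegrals

/-! ### Centred Gaussian vectors are determined by their covariance. -/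

section GaussianVectors

variable {Ω : Type*} [MeasurableSpace Ω] {P : Measure Ω} [IsProbabilityMeasure P]

theorem identDistrib_of_covariance_eq {ι : Type*} [Fintype ι] {X Y : ι → Ω → ℝ}
    (hX : HasGaussianLaw (fun ω i => X i ω) P) (hY : HasGaussianLaw (fun ω i => Y i ω) P)
    (hX0 : ∀ i, ∫ ω, X i ω ∂P = 0) (hY0 : ∀ i, ∫ ω, Y i ω ∂P = 0)
    (h : ∀ i k, ∫ ω, X i ω * X k ω ∂P = ∫ ω, Y i ω * Y k ω ∂P) :
    IdentDistrib (fun ω i => X i ω) (fun ω i => Y i ω) P P := by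
  classical
  refine ⟨hX.aemeasurable, hY.aemeasurable, ?_⟩
  have := P.isProbabilityMeasure_map hX.aemeasurable
  have := P.isProbabilityMeasure_map hY.aemeasurable
  refine Measure.ext_of_charFunDual (funext fun L => ?_)
  rw [hX.charFunDual_map_eq_fun, hY.charFunDual_map_eq_fun]
  set c : ι → ℝ := fun i => L (Pi.single i 1) with hc
  have hL : ∀ y : ι → ℝ, L y = ∑ i, c i * y i := fun y => by
    conv_lhs => rw [pi_eq_sum_univ' y]
    rw [map_sum]
    refine Finset.sum_congr rfl fun i _ => ?_
    rw [map_smul, smul_eq_mul, mul_comm]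
  have mean {Z : ι → Ω → ℝ} (hZ : HasGaussianLaw (fun ω i => Z i ω) P)
      (hZ0 : ∀ i, ∫ ω, Z i ω ∂P = 0) : ∫ ω, L (fun i => Z i ω) ∂P = 0 := by
    simp_rw [hL]
    rw [integral_finsetSum _ fun i _ => (hZ.eval i).integrable.const_mul _]
    simp_rw [integral_const_mul, hZ0, mul_zero, Finset.sum_const_zero]
  have var {Z : ι → Ω → ℝ} (hZ : HasGaussianLaw (fun ω i => Z i ω) P)
      (hZ0 : ∀ i, ∫ ω, Z i ω ∂P = 0) : Var[fun ω => L (fun i => Z i ω); P] =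
        ∑ i, ∑ k, c i * c k * ∫ ω, Z i ω * Z k ω ∂P := by
    rw [variance_of_integral_eq_zero (hZ.map_fun L).aemeasurable (mean hZ hZ0)]
    have e (ω : Ω) : L (fun i => Z i ω) ^ 2 = ∑ i, ∑ k, c i * c k * (Z i ω * Z k ω) := by
      rw [hL, sq, Finset.sum_mul_sum]
      exact Finset.sum_congr rfl fun i _ => Finset.sum_congr rfl fun k _ => by ring
    simp_rw [e]
    have hi (i k : ι) : Integrable (fun ω => c i * c k * (Z i ω * Z k ω)) P :=
      ((hZ.eval i).memLp_two.integrable_mul (hZ.eval k).memLp_two).const_mul _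
    rw [integral_finsetSum _ fun i _ => integrable_finsetSum _ fun k _ => hi i k]
    refine Finset.sum_congr rfl fun i _ => ?_
    rw [integral_finsetSum _ fun k _ => hi i k]
    simp_rw [integral_const_mul]
  rw [mean hX hX0, mean hY hY0, var hX hX0, var hY hY0]
  simp_rw [h]

end GaussianVectors

/-! ### Hermite polynomials and Mehler's formula. -/

section Hermite

open Polynomial

/-- The Hermite polynomial with real coefficients. -/
def hermiteR (n : ℕ) : ℝ[X] := (hermite n).map (Int.castRingHom ℝ)

theorem aeval_hermite (n : ℕ) (x : ℝ) : aeval x (hermite n) = (hermiteR n).eval x := by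
  rw [hermiteR, eval_map, aeval_def]
  rfl

theorem hermiteR_succ (n : ℕ) :
    hermiteR (n + 1) = X * hermiteR n - derivative (hermiteR n) := by
  simp [hermiteR, hermite_succ, derivative_map]

theorem iterate_derivative_hermiteR (n : ℕ) : derivative^[n] (hermiteR n) = C (n ! : ℝ) := by
  have hdeg : (hermiteR n).natDegree = n := by
    rw [hermiteR, natDegree_map_eq_of_injective Int.cast_injective, natDegree_hermite]
  have h0 : (derivative^[n] (hermiteR n)).natDegree = 0 := by
    have := natDegree_iterate_derivative (hermiteR n) n
    omega
  rw [eq_C_of_natDegree_eq_zero h0, coeff_iterate_derivative, zero_add, Nat.descFactorial_self]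
  simp [hermiteR]

theorem iterate_derivative_comp_linear (p : ℝ[X]) (a w : ℝ) (n : ℕ) :
    derivative^[n] (p.comp (C a * X + C w)) =
      C (a ^ n) * (derivative^[n] p).comp (C a * X + C w) := by
  induction n with
  | zero => simp
  | succ n ih =>
    rw [Function.iterate_succ_apply', ih, Function.iterate_succ_apply', derivative_C_mul,
      derivative_comp]
    simp only [derivative_add, derivative_C_mul, derivative_X, derivative_C, mul_one, add_zero]
    rw [pow_succ, C_mul]
    ring

theorem integrable_eval_gaussianReal (p : ℝ[X]) (m : ℝ) (v : NNReal) :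
    Integrable (fun x => p.eval x) (gaussianReal m v) := by
  simp_rw [eval_eq_sum_range]
  refine integrable_finsetSum _ fun i _ => Integrable.const_mul ?_ _
  exact (memLp_id_gaussianReal (i : NNReal)).integrable_norm_pow' |>.mono
    (by fun_prop) (Filter.Eventually.of_forall fun x => by simp)

/-- Gaussian integration by parts. -/
theorem integral_mul_eval_gaussianReal (p : ℝ[X]) :
    ∫ x, x * p.eval x ∂(gaussianReal 0 1) = ∫ x, (derivative p).eval x ∂(gaussianReal 0 1) := by
  have hint (p : ℝ[X]) : Integrable (fun x => gaussianPDFReal 0 1 x * p.eval x) := by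
    have := integrable_eval_gaussianReal p 0 1
    rw [gaussianReal_of_var_ne_zero 0 one_ne_zero, integrable_withDensity_iff_integrable_smul'
      (measurable_gaussianPDF 0 1) (Filter.Eventually.of_forall fun x => gaussianPDF_lt_top)] at this
    simpa only [toReal_gaussianPDF, smul_eq_mul] using this
  have hpdf : ∀ x, HasDerivAt (gaussianPDFReal 0 1) (-x * gaussianPDFReal 0 1 x) x := by
    intro x
    rw [gaussianPDFReal_def]
    have h1 : HasDerivAt (fun x : ℝ => -(x - 0) ^ 2 / (2 * (1 : NNReal))) (-x) x := by
      have := (((hasDerivAt_id x).sub_const 0).pow 2).neg.div_const (2 * ((1 : NNReal) : ℝ))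
      convert! this using 1
      simp
      ring
    convert! (h1.exp.const_mul (√(2 * Real.pi * (1 : NNReal)))⁻¹) using 1
    ring
  have key := integral_eq_zero_of_hasDerivAt_of_integrable
    (f := fun x => gaussianPDFReal 0 1 x * p.eval x)
    (f' := fun x => gaussianPDFReal 0 1 x * (derivative p - X * p).eval x)
    (fun x => by
      convert! (hpdf x).mul (p.hasDerivAt x) using 1
      simp
      ring) (hint _) (hint _)
  have e : ∫ x, (derivative p - X * p).eval x ∂(gaussianReal 0 1) = 0 := by
    rw [integral_gaussianReal_eq_integral_smul one_ne_zero]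
    simpa only [smul_eq_mul] using key
  simp_rw [eval_sub] at e
  rw [integral_sub (integrable_eval_gaussianReal _ _ _) (integrable_eval_gaussianReal _ _ _)] at e
  simp_rw [eval_mul, eval_X] at e
  linarith

/-- The operator `p ↦ xp - p'` producing `H_{n+1}` from `H_n` is adjoint to differentiation under
the standard Gaussian measure. -/
theorem integral_hermiteR_mul (n : ℕ) (r : ℝ[X]) :
    ∫ x, (hermiteR n).eval x * r.eval x ∂(gaussianReal 0 1) =
      ∫ x, (derivative^[n] r).eval x ∂(gaussianReal 0 1) := by
  induction n generalizing r with
  | zero => simp [hermiteR]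
  | succ n ih =>
    have h1 := integral_mul_eval_gaussianReal (hermiteR n * r)
    have h2 := ih (derivative r)
    have hi (p : ℝ[X]) := integrable_eval_gaussianReal p 0 1
    rw [Function.iterate_succ_apply, ← h2, hermiteR_succ]
    rw [derivative_mul] at h1
    have e1 : ∀ x, (X * hermiteR n - derivative (hermiteR n)).eval x * r.eval x =
        (X * (hermiteR n * r)).eval x - (derivative (hermiteR n) * r).eval x := fun x => by
      simp; ring
    simp_rw [e1]
    rw [integral_sub (hi _) (hi _)]
    simp_rw [eval_add] at h1
    rw [integral_add (hi _) (hi _)] at h1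
    simp_rw [← eval_mul]
    have e2 : ∀ x, (X * (hermiteR n * r)).eval x = x * (hermiteR n * r).eval x := fun x => by simp
    simp_rw [e2, h1]
    ring

variable {Ω : Type*} [MeasurableSpace Ω] {P : Measure Ω}

theorem map_eq_stdGaussian {X : Ω → ℝ} (hX : HasGaussianLaw X P) (h0 : ∫ ω, X ω ∂P = 0)
    (h1 : ∫ ω, X ω ^ 2 ∂P = 1) : P.map X = gaussianReal 0 1 := by
  rw [hX.map_eq_gaussianReal, variance_of_integral_eq_zero hX.aemeasurable h0, h0, h1]
  simp

theorem memLp_eval_of_hasGaussianLaw {X : Ω → ℝ} (hX : HasGaussianLaw X P) (p : ℝ[X]) :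
    MemLp (fun ω => p.eval (X ω)) 2 P := by
  have hm : AEMeasurable (fun ω => p.eval (X ω)) P := p.continuous.measurable.comp_aemeasurable
    hX.aemeasurable
  rw [memLp_two_iff_integrable_sq hm.aestronglyMeasurable]
  have := integrable_eval_gaussianReal (p ^ 2) (∫ ω, X ω ∂P) (Var[X; P]).toNNReal
  rw [← hX.map_eq_gaussianReal, integrable_map_measure (p ^ 2).continuous.aestronglyMeasurable
    hX.aemeasurable] at this
  refine this.congr (Filter.Eventually.of_forall fun ω => ?_)
  simp

theorem integral_hermiteR {X : Ω → ℝ} (hX : HasGaussianLaw X P) (h0 : ∫ ω, X ω ∂P = 0)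
    (h1 : ∫ ω, X ω ^ 2 ∂P = 1) (n : ℕ) (hn : n ≠ 0) : ∫ ω, (hermiteR n).eval (X ω) ∂P = 0 := by
  have := integral_hermiteR_mul n 1
  rw [iterate_derivative_one (Nat.pos_of_ne_zero hn)] at this
  simp only [eval_one, mul_one, eval_zero, integral_zero] at this
  rwa [← map_eq_stdGaussian hX h0 h1, integral_map hX.aemeasurable
    (hermiteR n).continuous.aestronglyMeasurable] at this

/-- Mehler's formula for the covariance of Hermite polynomials of jointly Gaussian variables. -/
theorem integral_hermiteR_mul_hermiteR [IsProbabilityMeasure P] {X Y : Ω → ℝ}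
    (hXY : HasGaussianLaw (fun ω => (X ω, Y ω)) P) (hX0 : ∫ ω, X ω ∂P = 0)
    (hX1 : ∫ ω, X ω ^ 2 ∂P = 1) (n : ℕ) :
    ∫ ω, (hermiteR n).eval (X ω) * (hermiteR n).eval (Y ω) ∂P =
      (n ! : ℝ) * (∫ ω, X ω * Y ω ∂P) ^ n := by
  set ρ := ∫ ω, X ω * Y ω ∂P with hρ
  have hX := hXY.fst
  have hY := hXY.snd
  let L : ℝ × ℝ →L[ℝ] ℝ × ℝ := (ContinuousLinearMap.fst ℝ ℝ ℝ).prod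
    (ContinuousLinearMap.snd ℝ ℝ ℝ - ρ • ContinuousLinearMap.fst ℝ ℝ ℝ)
  -- `W` is the part of `Y` uncorrelated with, hence independent of, `X`. The variance of `Y` never
  -- enters.
  set W : Ω → ℝ := fun ω => Y ω - ρ * X ω with hW
  have hXW : HasGaussianLaw (fun ω => (X ω, W ω)) P := hXY.map_fun L
  have hcov : cov[X, W; P] = 0 := by
    rw [covariance_eq_sub hX.memLp_two hXW.snd.memLp_two, hX0, zero_mul, sub_zero]
    have e : ∀ ω, (X * W) ω = X ω * Y ω - ρ * X ω ^ 2 := fun ω => by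
      simp only [Pi.mul_apply, hW]; ring
    simp_rw [e]
    have i1 : Integrable (fun ω => X ω * Y ω) P := hX.memLp_two.integrable_mul hY.memLp_two
    rw [integral_sub i1 (hX.memLp_two.integrable_sq.const_mul _), integral_const_mul, hX1, ← hρ]
    ring
  have hind := hXW.indepFun_of_covariance_eq_zero hcov
  rw [indepFun_iff_map_prod_eq_prod_map_map hX.aemeasurable hXW.snd.aemeasurable,
    map_eq_stdGaussian hX hX0 hX1] at hind
  have hWp := P.isProbabilityMeasure_map hXW.snd.aemeasurable
  let F : ℝ × ℝ → ℝ := fun p => (hermiteR n).eval p.1 * (hermiteR n).eval (ρ * p.1 + p.2)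
  have hF : Continuous F := by
    have := (hermiteR n).continuous
    exact (this.comp continuous_fst).mul (this.comp (by fun_prop))
  have e1 : ∀ ω, (hermiteR n).eval (X ω) * (hermiteR n).eval (Y ω) = F (X ω, W ω) := fun ω => by
    simp [F, hW]
  have hint : Integrable F ((gaussianReal 0 1).prod (P.map W)) := by
    rw [← hind, integrable_map_measure hF.aestronglyMeasurable hXW.aemeasurable]
    exact ((memLp_eval_of_hasGaussianLaw hX _).integrable_mul
      (memLp_eval_of_hasGaussianLaw hY _)).congr (Filter.Eventually.of_forall e1)
  simp_rw [e1]
  rw [← integral_map (f := F) hXW.aemeasurable hF.aestronglyMeasurable, hind,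
    integral_prod_symm _ hint]
  -- The `n`-th derivative of `H_n(ρx + w)` is the constant `n! ρ^n`, so the law of `W` is
  -- irrelevant.
  have e2 : ∀ w, ∫ x, F (x, w) ∂(gaussianReal 0 1) = (n ! : ℝ) * ρ ^ n := fun w => by
    have := integral_hermiteR_mul n ((hermiteR n).comp (C ρ * Polynomial.X + C w))
    rw [iterate_derivative_comp_linear, iterate_derivative_hermiteR] at this
    simp only [eval_comp, eval_add, eval_mul, eval_C, eval_X, C_comp, integral_const,
      probReal_univ, one_smul] at this
    rw [mul_comm, ← this]
  simp_rw [e2]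
  simp

end Hermite

/-! ### Kernels with finite Legendre expansions. -/

section BandLimited

/-- The kernel with the finite Legendre expansion `∑_{ℓ < N} c_ℓ (2ℓ+1)/(4π) P_ℓ`. -/
def sumK (N : ℕ) (c : ℕ → ℝ) (x y : S2) : ℝ := ∑ l ∈ Finset.range N, c l * legK l x y

theorem zonalKernel_sumK (N : ℕ) (c : ℕ → ℝ) : ZonalKernel (sumK N c) :=
  .of_continuous (f := fun t => ∑ l ∈ Finset.range N,
      c l * ((2 * (l : ℝ) + 1) / (4 * Real.pi) * legendreP l t))
    (continuous_finsetSum _ fun l _ =>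
      continuous_const.mul (continuous_const.mul (continuous_legendreP l)))

theorem conv_legK_sumK (N : ℕ) (c : ℕ → ℝ) {l : ℕ} (hl : l < N) (x y : S2) :
    conv (legK l) (sumK N c) x y = c l * legK l x y := by
  rw [(zonalKernel_legK l).conv_comm (zonalKernel_sumK N c),
    conv_sum_legK (A := sumK N c) (zonalKernel_legK l) c (Finset.range N) (fun _ _ => rfl),
    Finset.sum_eq_single_of_mem l (Finset.mem_range.2 hl)
      (fun k _ hk => by rw [conv_legK_legK, if_neg hk, mul_zero]), conv_legK_legK, if_pos rfl]

/-- Each degree is an eigenspace, so filtering on both sides squares the multiplier. Used once with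
the needlet kernel around `Γ` and once with `K` around the Hermite covariance. -/
theorem conv_sumK_conv_sumK {G : S2 → S2 → ℝ} (hG : ZonalKernel G) (N : ℕ) (a c : ℕ → ℝ)
    (hc : ∀ l < N, ∀ x y, conv (legK l) G x y = c l * legK l x y) (x y : S2) :
    conv (conv (sumK N a) G) (sumK N a) x y = sumK N (fun l => a l ^ 2 * c l) x y := by
  have h1 : ∀ x y, conv (sumK N a) G x y =
      ∑ l ∈ Finset.range N, (a l * c l) * legK l x y := fun x y => by
    rw [conv_sum_legK (A := sumK N a) hG a (Finset.range N) (fun _ _ => rfl)]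
    exact Finset.sum_congr rfl fun l hl => by rw [hc l (Finset.mem_range.1 hl), mul_assoc]
  rw [conv_sum_legK (zonalKernel_sumK N a) _ (Finset.range N) h1, sumK]
  refine Finset.sum_congr rfl fun l hl => ?_
  rw [conv_legK_sumK N a (Finset.mem_range.1 hl)]
  ring

end BandLimited

/-! ### Covariance of an isotropic field and its angular power spectrum. -/

section Covariance

variable {Ω : Type*} [MeasurableSpace Ω] {P : Measure Ω}

/-- The covariance kernel of a centred field. -/
def covK (P : Measure Ω) (X : S2 → Ω → ℝ) (x y : S2) : ℝ := ∫ ω, X x ω * X y ω ∂P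

theorem integral_kernel_mul_kernel [IsFiniteMeasure P] {X : S2 → Ω → ℝ} (hX : L2Field X P)
    (hG : ZonalKernel (covK P X)) {A B : S2 → S2 → ℝ} (hA : ZonalKernel A) (hB : ZonalKernel B)
    (x y : S2) :
    ∫ ω, (∫ u, A x u * X u ω ∂area) * (∫ v, B y v * X v ω ∂area) ∂P =
      conv (conv A (covK P X)) B x y := by
  obtain ⟨C, hC⟩ := hA.bounded
  obtain ⟨C', hC'⟩ := hB.bounded
  rw [(hX.mul_left (hA.measurable_right x) (hC x)).integral_integral_mul_integral
    (hX.mul_left (hB.measurable_right y) (hC' y)), hA.conv_assoc hG hB]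
  have e : ∀ u v, ∫ ω, A x u * X u ω * (B y v * X v ω) ∂P = A x u * (covK P X u v * B v y) := by
    intro u v
    rw [hB.symm v y, covK, ← integral_mul_const, ← integral_const_mul]
    exact integral_congr_ae (Filter.Eventually.of_forall fun ω => by ring)
  simp_rw [e, integral_const_mul]
  rfl

theorem l2Field_of_isIsotropic {T : S2 → Ω → ℝ}
    (hTmeas : Measurable (Function.uncurry T)) (hTgauss : IsGaussianProcess T P)
    (hTiso : IsIsotropic T P) : L2Field T P where
  measurable := hTmeas
  memLp x := (hTgauss.hasGaussianLaw_eval x).memLp_two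
  bounded := by
    refine ⟨∫ ω, T pole ω ^ 2 ∂P, fun x => le_of_eq ?_⟩
    obtain ⟨R, hR, hx, _⟩ := exists_rotation (x := pole) (y := pole) (x' := x) (y' := x)
      (by rw [dot_self, dot_self])
    have h := (hTiso R hR 1 fun _ => pole).comp
      (u := fun v : Fin 1 → ℝ => v 0 ^ 2) (by fun_prop)
    have := h.integral_eq
    simpa only [Function.comp_def, hx] using this

/-- Invariance of the two-point laws and transitivity on equidistant pairs give zonality;
measurability comes from joint measurability of `T`, so continuity of the covariance is not needed.
-/
theorem zonalKernel_covK [IsProbabilityMeasure P] {T : S2 → Ω → ℝ} (hT : L2Field T P)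
    (hTiso : IsIsotropic T P) : ZonalKernel (covK P T) where
  measurable := by
    have : StronglyMeasurable fun p : (S2 × S2) × Ω => T p.1.1 p.2 * T p.1.2 p.2 :=
      ((hT.measurable.comp (by fun_prop : Measurable fun p : (S2 × S2) × Ω => (p.1.1, p.2))).mul
        (hT.measurable.comp
          (by fun_prop : Measurable fun p : (S2 × S2) × Ω => (p.1.2, p.2)))).stronglyMeasurable
    exact (this.integral_prod_right' (ν := P)).measurable
  bounded := by
    obtain ⟨M, hM⟩ := hT.bounded
    refine ⟨M, fun x y => ?_⟩
    have i1 := (hT.memLp x).integrable_sq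
    have i2 := (hT.memLp y).integrable_sq
    have i3 : Integrable (fun ω => T x ω * T y ω) P := (hT.memLp x).integrable_mul (hT.memLp y)
    calc
      |∫ ω, T x ω * T y ω ∂P| ≤ ∫ ω, |T x ω * T y ω| ∂P := abs_integral_le_integral_abs
      _ ≤ ∫ ω, (T x ω ^ 2 + T y ω ^ 2) / 2 ∂P := by
        refine integral_mono i3.abs ((i1.add i2).div_const 2) fun ω => ?_
        simp only
        rw [abs_le]
        constructor <;> nlinarith [sq_nonneg (T x ω + T y ω), sq_nonneg (T x ω - T y ω)]
      _ = (∫ ω, T x ω ^ 2 ∂P + ∫ ω, T y ω ^ 2 ∂P) / 2 := by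
        rw [integral_div, integral_add i1 i2]
      _ ≤ M := by linarith [hM x, hM y]
  zonal := by
    intro x y x' y' h
    obtain ⟨R, hR, hx, hy⟩ := exists_rotation h
    have h := (hTiso R hR 2 ![x, y]).comp
      (u := fun v : Fin 2 → ℝ => v 0 * v 1) (by fun_prop)
    have := h.integral_eq
    simp only [Function.comp_def, Matrix.cons_val_zero, Matrix.cons_val_one, hx, hy] at this
    exact this.symm

theorem harmonicCoeff_zero {Ω : Type*} (T : S2 → Ω → ℝ) (l : ℕ) (ω : Ω) :
    harmonicCoeff T l 0 ω =
      ((∫ u, √(4 * Real.pi / (2 * (l : ℝ) + 1)) * (legK l pole u * T u ω) ∂area : ℝ) : ℂ) := by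
  rw [harmonicCoeff, ← integral_complex_ofReal]
  refine integral_congr_ae (Filter.Eventually.of_forall fun u => ?_)
  have hf : ((l ! : ℝ) / (l ! : ℝ)) = 1 := div_self (by positivity)
  have hs : √((2 * (l : ℝ) + 1) / (4 * Real.pi)) =
      √(4 * Real.pi / (2 * (l : ℝ) + 1)) * ((2 * (l : ℝ) + 1) / (4 * Real.pi)) := by
    have hpi := Real.pi_pos
    rw [← inv_div (2 * (l : ℝ) + 1), Real.sqrt_inv]
    have hpos : 0 < (2 * (l : ℝ) + 1) / (4 * Real.pi) := by positivity
    rw [eq_inv_mul_iff_mul_eq₀ (Real.sqrt_pos.2 hpos).ne', Real.mul_self_sqrt hpos.le]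
  have hY : sphericalHarmonic l 0 u =
      ((√(4 * Real.pi / (2 * (l : ℝ) + 1)) * legK l pole u : ℝ) : ℂ) := by
    simp only [sphericalHarmonic, Int.natAbs_zero, tsub_zero, add_zero, hf, mul_one, pow_zero,
      le_refl, if_true, one_mul, Function.iterate_zero, id, hs]
    rw [legK, dot_comm, dot_pole, legendreP, mul_assoc]
  beta_reduce
  rw [hY, Complex.conj_ofReal]
  push_cast
  ring

/-- Since `a_{ℓ0}` is `√(4π/(2ℓ+1))` times the integral of `T` against `K_ℓ(pole, ·)`, its second
moment is `4π/(2ℓ+1)` times `K_ℓ * Γ * K_ℓ = c K_ℓ` on the diagonal, which equals `c`. -/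
theorem angularPower_eq [IsFiniteMeasure P] {T : S2 → Ω → ℝ} (hT : L2Field T P)
    (hG : ZonalKernel (covK P T)) {l : ℕ} {c : ℝ}
    (hc : ∀ x y, conv (legK l) (covK P T) x y = c * legK l x y) : angularPower P T l = c := by
  have h4 : (0 : ℝ) ≤ 4 * Real.pi / (2 * (l : ℝ) + 1) := by have := Real.pi_pos; positivity
  have e : ∀ ω, ‖harmonicCoeff T l 0 ω‖ ^ 2 = 4 * Real.pi / (2 * (l : ℝ) + 1) *
      ((∫ u, legK l pole u * T u ω ∂area) * (∫ u, legK l pole u * T u ω ∂area)) := fun ω => by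
    rw [harmonicCoeff_zero, Complex.norm_real, Real.norm_eq_abs, sq_abs, integral_const_mul,
      mul_pow, Real.sq_sqrt h4, sq (∫ u, _ ∂area)]
  rw [angularPower]
  simp_rw [e]
  rw [integral_const_mul, integral_kernel_mul_kernel hT hG (zonalKernel_legK l)
    (zonalKernel_legK l), conv_sum_legK (zonalKernel_legK l) (fun _ => c) {l}
      (fun x y => by rw [Finset.sum_singleton, hc]), Finset.sum_singleton, conv_legK_legK,
    if_pos rfl, legK_self]
  have : (2 * (l : ℝ) + 1) ≠ 0 := by positivity
  have := Real.pi_ne_zero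
  field_simp

end Covariance

/-! ### Interpolation of polynomial kernels by finitely many sections. -/

section Interpolation

/-- A finite-dimensional family of vectors is interpolated by finitely many of its members. -/
theorem exists_interpolation {X σ : Type} [Fintype σ] (A : X → σ → ℝ) :
    ∃ (ι : Type) (_ : Fintype ι) (z : ι → X) (f : ι → (σ → ℝ) →ₗ[ℝ] ℝ),
      ∀ x, A x = ∑ i, f i (A x) • A (z i) := by
  obtain ⟨s, hs, hspan, hli⟩ := exists_linearIndependent ℝ (Set.range A)
  have hfin : Finite s := hli.finite
  have := Fintype.ofFinite s
  let bas := Module.Basis.span hli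
  choose z hz using fun i : s => hs i.2
  -- Coordinates in a basis chosen among the vectors, extended to the whole space so that they
  -- become linear, hence measurable, functions of `A x`.
  choose f hf using fun i : s => LinearMap.exists_extend (bas.coord i)
  refine ⟨s, inferInstance, z, f, fun x => ?_⟩
  have hx : A x ∈ Submodule.span ℝ (Set.range ((↑) : s → σ → ℝ)) := by
    rw [Subtype.range_coe, hspan]
    exact Submodule.subset_span (Set.mem_range_self x)
  have h := congrArg Subtype.val (bas.sum_repr ⟨A x, hx⟩)
  simp only [Submodule.coe_sum, Submodule.coe_smul] at h
  rw [← h]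
  refine Finset.sum_congr rfl fun i _ => ?_
  rw [hz, Module.Basis.span_apply]
  congr 1
  have := LinearMap.congr_fun (hf i) ⟨A x, hx⟩
  rw [h]
  exact this.symm

theorem dot_pow_eq (x y : S2) (n : ℕ) : dot x y ^ n =
    ∑ p : Fin n → Fin 3, (∏ i, (x : E3) (p i)) * ∏ i, (y : E3) (p i) := by
  rw [dot_eq_sum, Finset.sum_pow', Fintype.piFinset_univ]
  exact Finset.sum_congr rfl fun p _ => Finset.prod_mul_distrib

open Polynomial in
/-- A polynomial kernel on the sphere is interpolated by finitely many of its sections. -/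
theorem exists_kernel_interpolation (p : ℝ[X]) :
    ∃ (ι : Type) (_ : Fintype ι) (z : ι → S2) (g : ι → S2 → ℝ), (∀ i, Measurable (g i)) ∧
      ∀ x y, p.eval (dot x y) = ∑ i, g i x * p.eval (dot (z i) y) := by
  -- All monomials in the coordinates, indexed by words: the kernel then factors through a
  -- finite-dimensional space.
  let A : S2 → (Σ n : Fin (p.natDegree + 1), (Fin n → Fin 3)) → ℝ :=
    fun x s => ∏ i, (x : E3) (s.2 i)
  let D : S2 → (Σ n : Fin (p.natDegree + 1), (Fin n → Fin 3)) → ℝ :=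
    fun y s => p.coeff s.1 * ∏ i, (y : E3) (s.2 i)
  have hAD : ∀ x y, p.eval (dot x y) = ∑ s, A x s * D y s := fun x y => by
    rw [eval_eq_sum_range, ← Fin.sum_univ_eq_sum_range (fun n => p.coeff n * dot x y ^ n),
      Fintype.sum_sigma]
    refine Finset.sum_congr rfl fun n _ => ?_
    rw [dot_pow_eq, Finset.mul_sum]
    refine Finset.sum_congr rfl fun q _ => ?_
    simp only [A, D]
    ring
  obtain ⟨ι, hι, z, f, hf⟩ := exists_interpolation A
  refine ⟨ι, hι, z, fun i x => f i (A x), fun i => ?_, fun x y => ?_⟩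
  · refine (LinearMap.continuous_of_finiteDimensional (f i)).measurable.comp ?_
    refine measurable_pi_lambda _ fun s => Finset.measurable_prod _ fun i _ => ?_
    exact (continuous_coord _).measurable
  · rw [hAD]
    simp_rw [hAD, Finset.mul_sum]
    rw [Finset.sum_comm]
    refine Finset.sum_congr rfl fun s _ => ?_
    conv_lhs => rw [hf x]
    rw [Finset.sum_apply, Finset.sum_mul]
    refine Finset.sum_congr rfl fun i _ => ?_
    rw [Pi.smul_apply, smul_eq_mul, mul_assoc]

theorem exists_sumK_interpolation (N : ℕ) (c : ℕ → ℝ) :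
    ∃ (ι : Type) (_ : Fintype ι) (z : ι → S2) (g : ι → S2 → ℝ), (∀ i, Measurable (g i)) ∧
      ∀ x y, sumK N c x y = ∑ i, g i x * sumK N c (z i) y := by
  have e : ∀ x y, sumK N c x y = (∑ l ∈ Finset.range N,
      Polynomial.C (c l * ((2 * (l : ℝ) + 1) / (4 * Real.pi))) * legendre l).eval (dot x y) := by
    intro x y
    rw [Polynomial.eval_finsetSum, sumK]
    refine Finset.sum_congr rfl fun l _ => ?_
    rw [Polynomial.eval_mul, Polynomial.eval_C, legK, legendreP, mul_assoc]
  simp_rw [e]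
  exact exists_kernel_interpolation _

end Interpolation

/-! ### Fields smoothed by a zonal kernel, and isotropy. -/

section KernelFields

variable {Ω : Type*} [MeasurableSpace Ω] {P : Measure Ω} [IsProbabilityMeasure P]

theorem l2Field_integral_kernel {X : S2 → Ω → ℝ} (hX : L2Field X P)
    (hG : ZonalKernel (covK P X)) {A : S2 → S2 → ℝ} (hA : ZonalKernel A) :
    L2Field (fun x ω => ∫ u, A x u * X u ω ∂area) P where
  measurable := by
    have : StronglyMeasurable fun p : (S2 × Ω) × S2 => A p.1.1 p.2 * X p.2 p.1.2 :=
      ((hA.measurable.comp (by fun_prop : Measurable fun p : (S2 × Ω) × S2 => (p.1.1, p.2))).mul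
        (hX.measurable.comp
          (by fun_prop : Measurable fun p : (S2 × Ω) × S2 => (p.2, p.1.2)))).stronglyMeasurable
    exact (this.integral_prod_right' (ν := area)).measurable
  memLp x := by
    obtain ⟨C, hC⟩ := hA.bounded
    exact (hX.mul_left (hA.measurable_right x) (hC x)).memLp_integral
  bounded := by
    obtain ⟨C, hC⟩ := ((hA.conv hG).conv hA).bounded
    refine ⟨C, fun x => ?_⟩
    simp_rw [sq]
    rw [integral_kernel_mul_kernel hX hG hA hA]
    exact (abs_le.1 (hC x x)).2

theorem integral_integral_kernel {X : S2 → Ω → ℝ} (hX : L2Field X P)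
    (h0 : ∀ x, ∫ ω, X x ω ∂P = 0) {A : S2 → S2 → ℝ} (hA : ZonalKernel A) (x : S2) :
    ∫ ω, ∫ u, A x u * X u ω ∂area ∂P = 0 := by
  obtain ⟨C, hC⟩ := hA.bounded
  rw [(hX.mul_left (hA.measurable_right x) (hC x)).integral_integral]
  simp_rw [integral_const_mul, h0, mul_zero, integral_zero]

theorem isGaussianProcess_integral_kernel {T : S2 → Ω → ℝ} (hT : L2Field T P)
    (hTg : IsGaussianProcess T P) (h0 : ∀ x, ∫ ω, T x ω ∂P = 0) {A : S2 → S2 → ℝ}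
    (hA : ZonalKernel A) : IsGaussianProcess (fun x ω => ∫ u, A x u * T u ω ∂area) P :=
  isGaussianProcess_integral hT hTg h0 hA.measurable_right fun x =>
    hA.bounded.imp fun _ hC => hC x

omit [IsProbabilityMeasure P] in
theorem hasGaussianLaw_pi {X : S2 → Ω → ℝ} (hX : IsGaussianProcess X P) {ι : Type}
    [Fintype ι] (z : ι → S2) : HasGaussianLaw (fun ω i => X (z i) ω) P := by
  let L : (↥(Finset.univ : Finset ι) → ℝ) →L[ℝ] ι → ℝ :=
    .pi fun i => .proj ⟨i, Finset.mem_univ i⟩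
  exact ((hX.comp_right z).hasGaussianLaw Finset.univ).map L

/-- Smoothing a local function of a band-limited centred Gaussian field with zonal covariance
gives an isotropic field. -/
theorem isIsotropic_integral_comp {β T : S2 → Ω → ℝ} (hT : L2Field T P)
    (hβ : IsGaussianProcess β P) (h0 : ∀ x, ∫ ω, β x ω ∂P = 0)
    (hG : ZonalKernel (covK P β)) (N : ℕ) (a : ℕ → ℝ)
    (hβT : ∀ x ω, β x ω = ∫ u, sumK N a x u * T u ω ∂area)
    {A : S2 → S2 → ℝ} (hA : ZonalKernel A) {F : ℝ → ℝ} (hF : Measurable F) :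
    IsIsotropic (fun x ω => ∫ y, A x y * F (β y ω) ∂area) P := by
  intro R _ n x
  obtain ⟨ι, _, z, g, hg, hsum⟩ := exists_sumK_interpolation N a
  have hae (z' : ι → S2) : ∀ᵐ ω ∂P, ∀ i, Integrable (fun u => sumK N a (z' i) u * T u ω) area := by
    rw [Filter.eventually_all]
    intro i
    obtain ⟨C, hC⟩ := (zonalKernel_sumK N a).bounded
    exact (hT.mul_left ((zonalKernel_sumK N a).measurable_right (z' i)) (hC (z' i))).ae_integrable
  -- The path is recovered from its values at the nodes; as the kernel is zonal, the same weights `g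
  -- i` serve for the rotated nodes.
  have hlin (S : E3 ≃ₗᵢ[ℝ] E3) (ω : Ω)
      (h : ∀ i, Integrable (fun u => sumK N a (rotate S (z i)) u * T u ω) area) (y : S2) :
      β (rotate S y) ω = ∑ i, g i y * β (rotate S (z i)) ω := by
    have e : ∀ y u, sumK N a (rotate S y) u = sumK N a y (rotate S.symm u) := fun y u =>
      (zonalKernel_sumK N a).zonal _ _ _ _ (dot_rotate_left S y u)
    simp_rw [hβT, ← integral_const_mul]
    rw [← integral_finsetSum _ fun i _ => (h i).const_mul _]
    refine integral_congr_ae (Filter.Eventually.of_forall fun u => ?_)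
    beta_reduce
    rw [e, hsum, Finset.sum_mul]
    exact Finset.sum_congr rfl fun i _ => by rw [e, mul_assoc]
  -- `Φ` does not depend on the rotation, so only the laws of the nodal Gaussian vectors remain to
  -- be compared.
  set Φ : (ι → ℝ) → Fin n → ℝ :=
    fun v k => ∫ y, A (x k) y * F (∑ i, g i y * v i) ∂area with hΦ
  have hΦm : Measurable Φ := by
    refine measurable_pi_lambda _ fun k => ?_
    have h1 : Measurable fun p : (ι → ℝ) × S2 => ∑ i, g i p.2 * p.1 i :=
      Finset.measurable_sum _ fun i _ =>
        ((hg i).comp measurable_snd).mul ((measurable_pi_apply i).comp measurable_fst)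
    have : StronglyMeasurable fun p : (ι → ℝ) × S2 => A (x k) p.2 * F (∑ i, g i p.2 * p.1 i) :=
      (((hA.measurable_right (x k)).comp measurable_snd).mul (hF.comp h1)).stronglyMeasurable
    exact (this.integral_prod_right' (ν := area)).measurable
  have key (S : E3 ≃ₗᵢ[ℝ] E3) : (fun ω k => ∫ y, A (rotate S (x k)) y * F (β y ω) ∂area) =ᵐ[P]
      Φ ∘ fun ω i => β (rotate S (z i)) ω := by
    filter_upwards [hae fun i => rotate S (z i)] with ω hω
    funext k
    simp only [hΦ, Function.comp_apply]
    rw [← integral_comp_rotate S]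
    refine integral_congr_ae (Filter.Eventually.of_forall fun y => ?_)
    beta_reduce
    rw [hA.rotate, hlin S ω hω]
  have hid : IdentDistrib (fun ω i => β (rotate R (z i)) ω) (fun ω i => β (z i) ω) P P :=
    identDistrib_of_covariance_eq (hasGaussianLaw_pi hβ fun i => rotate R (z i))
      (hasGaussianLaw_pi hβ z) (fun i => h0 _) (fun i => h0 _)
      (fun i k => hG.rotate R (z i) (z k))
  have hid' := hid.comp hΦm
  have key1 : (fun ω k => ∫ y, A (x k) y * F (β y ω) ∂area) =ᵐ[P]
      Φ ∘ fun ω i => β (z i) ω := key (LinearIsometryEquiv.refl ℝ E3)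
  exact ((IdentDistrib.of_ae_eq hid'.aemeasurable_fst (key R).symm).symm.trans hid').trans
    (IdentDistrib.of_ae_eq hid'.aemeasurable_snd key1.symm)

end KernelFields

/-! ### Hermite transforms of a normalised Gaussian field. -/

section HermiteFields

variable {Ω : Type*} [MeasurableSpace Ω] {P : Measure Ω} [IsProbabilityMeasure P]
  {β : S2 → Ω → ℝ}

theorem covK_hermite (hβ : IsGaussianProcess β P) (h0 : ∀ x, ∫ ω, β x ω ∂P = 0)
    (h1 : ∀ x, ∫ ω, β x ω ^ 2 ∂P = 1) (q : ℕ) (x y : S2) :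
    covK P (fun y ω => (hermiteR q).eval (β y ω)) x y = (q ! : ℝ) * covK P β x y ^ q :=
  integral_hermiteR_mul_hermiteR hβ.hasGaussianLaw_prodMk (h0 x) (h1 x) q

theorem l2Field_hermite (hβm : Measurable (Function.uncurry β)) (hβ : IsGaussianProcess β P)
    (h0 : ∀ x, ∫ ω, β x ω ∂P = 0) (h1 : ∀ x, ∫ ω, β x ω ^ 2 ∂P = 1) (q : ℕ) :
    L2Field (fun y ω => (hermiteR q).eval (β y ω)) P where
  measurable := (hermiteR q).continuous.measurable.comp hβm
  memLp y := memLp_eval_of_hasGaussianLaw (hβ.hasGaussianLaw_eval y) _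
  bounded := by
    refine ⟨q !, fun x => ?_⟩
    have h := covK_hermite hβ h0 h1 q x x
    simp only [covK, ← sq, h1, one_pow, mul_one] at h
    exact h.le

end HermiteFields

/-! ### Legendre expansion of powers of a band-limited kernel. -/

section PowerExpansion

/-- The Legendre coefficients of the power of a band-limited kernel. -/
theorem sumK_pow {n : ℕ} (N M : ℕ) (hM : (n + 2) * N ≤ M) (a : ℕ → ℝ) (x y : S2) :
    sumK N a x y ^ (n + 2) = ∑ L ∈ Finset.range M,
      (∑ ls ∈ Fintype.piFinset fun _ : Fin (n + 2) => Finset.range N, cgConvolution (n + 2) ls L *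
        ∏ k, (a (ls k) * ((2 * (ls k : ℝ) + 1) / (4 * Real.pi)))) * legendreP L (dot x y) := by
  have hp := Finset.sum_pow' (Finset.range N) (fun l => a l * legK l x y) (n + 2)
  rw [sumK, hp]
  simp_rw [Finset.sum_mul]
  rw [Finset.sum_comm]
  refine Finset.sum_congr rfl fun ls hls => ?_
  have hlt : ∑ k, ls k < M := by
    refine lt_of_lt_of_le (Finset.sum_lt_sum_of_nonempty Finset.univ_nonempty fun k _ =>
      Finset.mem_range.1 (Fintype.mem_piFinset.1 hls k)) ?_
    simpa using hM
  have e : ∏ k, a (ls k) * legK (ls k) x y =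
      (∏ k, (a (ls k) * ((2 * (ls k : ℝ) + 1) / (4 * Real.pi)))) *
        ∏ k, legendreP (ls k) (dot x y) := by
    rw [← Finset.prod_mul_distrib]
    exact Finset.prod_congr rfl fun k _ => by rw [legK, mul_assoc]
  rw [e, prod_legendreP ls _ M hlt, Finset.mul_sum]
  exact Finset.sum_congr rfl fun L _ => by ring

theorem sum_mul_legendreP_eq_sumK (M : ℕ) (e : ℕ → ℝ) (x y : S2) :
    ∑ L ∈ Finset.range M, e L * legendreP L (dot x y) =
      sumK M (fun L => e L / ((2 * (L : ℝ) + 1) / (4 * Real.pi))) x y := by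
  refine Finset.sum_congr rfl fun L _ => ?_
  have := Real.pi_pos
  have h : (2 * (L : ℝ) + 1) / (4 * Real.pi) ≠ 0 := by positivity
  rw [legK, ← mul_assoc, div_mul_cancel₀ _ h]

end PowerExpansion

/-! ### The needlet kernel as a finite sum. -/

section Needlets

theorem exists_needlet_cutoff {B : ℝ} (hB : 1 < B) {b : ℝ → ℝ}
    (hb : ∀ t, t ∉ Set.Icc B⁻¹ B → b t = 0) (j : ℕ) :
    ∃ N : ℕ, ∀ l : ℕ, N ≤ l → b ((l : ℝ) / B ^ j) = 0 := by
  obtain ⟨N, hN⟩ := exists_nat_gt (B * B ^ j)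
  refine ⟨N, fun l hl => hb _ fun h => ?_⟩
  have h2 := (div_le_iff₀ (by positivity)).1 h.2
  have : (N : ℝ) ≤ l := Nat.cast_le.2 hl
  linarith

theorem needletKernel_dot {B : ℝ} {b : ℝ → ℝ} {j N : ℕ}
    (hN : ∀ l : ℕ, N ≤ l → b ((l : ℝ) / B ^ j) = 0) (x y : S2) :
    needletKernel b B j (dot x y) = sumK N (fun l => b ((l : ℝ) / B ^ j)) x y := by
  rw [needletKernel, tsum_eq_sum (s := Finset.range N)]
  · exact Finset.sum_congr rfl fun l _ => by rw [legK, mul_assoc]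
  · intro l hl
    rw [hN l (by simpa using hl), zero_mul, zero_mul]

end Needlets

end SphericalField

end

/-! ### Assembly of the covariance formula. -/

theorem mainTheorem7 {Ω : Type*} [MeasurableSpace Ω] (P : Measure Ω) [IsProbabilityMeasure P]
    -- a jointly measurable, zero-mean, isotropic Gaussian field on the sphere
    (T : S2 → Ω → ℝ) (hTmeas : Measurable (Function.uncurry T))
    (hTgauss : IsGaussianProcess T P) (hTmean : ∀ x, ∫ ω, T x ω ∂P = 0)
    (hTiso : IsIsotropic T P)
    -- the needlet weight, with the normalisation `E β_j(x)² = 1`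
    (B : ℝ) (hB : 1 < B) (b : ℝ → ℝ) (hb : ∀ t, t ∉ Set.Icc B⁻¹ B → b t = 0) (j : ℕ)
    (hvar : ∀ x, ∫ ω, needletField T b B j x ω ^ 2 ∂P = 1)
    -- the smoothing kernel, with its finite Legendre expansion
    (LK : ℕ) (κ : ℕ → ℝ) (K : ℝ → ℝ)
    (hK : ∀ t ∈ Set.Icc (-1 : ℝ) 1, K t =
      ∑ l ∈ Finset.range (LK + 1), (2 * (l : ℝ) + 1) / (4 * Real.pi) * κ l * legendreP l t)
    (q : ℕ) (hq : 3 ≤ q) :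
    (∀ x, MemLp (gField P T b B j K q x) 2 P) ∧
    (∀ x, ∫ ω, gField P T b B j K q x ω ∂P = 0) ∧
    IsIsotropic (gField P T b B j K q) P ∧
    ∀ x₁ x₂ : S2,
      ∫ ω, gField P T b B j K q x₁ ω * gField P T b B j K q x₂ ω ∂P =
        (q ! : ℝ) * ∑ l ∈ Finset.range (LK + 1), κ l ^ 2 *
          (∑' ls : Fin q → ℕ, cgConvolution q ls l *
            ∏ k : Fin q, (b ((ls k : ℝ) / B ^ j) ^ 2 *
              ((2 * (ls k : ℝ) + 1) / (4 * Real.pi)) * angularPower P T (ls k))) *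
          legendreP l (dot x₁ x₂) := by
  obtain ⟨n, rfl⟩ : ∃ n, q = n + 2 := ⟨q - 2, by omega⟩
  obtain ⟨N, hN⟩ := exists_needlet_cutoff hB hb j
  set a : ℕ → ℝ := fun l => b ((l : ℝ) / B ^ j) with ha
  have hT := l2Field_of_isIsotropic hTmeas hTgauss hTiso
  have hG := zonalKernel_covK hT hTiso
  have hc : ∀ l x y, conv (legK l) (covK P T) x y = angularPower P T l * legK l x y := fun l => by
    obtain ⟨c, hc⟩ := conv_legK_eq hG l
    rwa [angularPower_eq hT hG hc]
  have hΨ := zonalKernel_sumK N a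
  -- the needlet field
  set β : S2 → Ω → ℝ := needletField T b B j with hβdef
  have hβT : β = fun x ω => ∫ u, sumK N a x u * T u ω ∂area := by
    funext x ω
    simp_rw [hβdef, needletField, needletKernel_dot hN, ha]
  have hβ2 : L2Field β P := hβT ▸ l2Field_integral_kernel hT hG hΨ
  have hβg : IsGaussianProcess β P := hβT ▸ isGaussianProcess_integral_kernel hT hTgauss hTmean hΨ
  have hβ0 : ∀ x, ∫ ω, β x ω ∂P = 0 := fun x => by
    rw [hβT]
    exact integral_integral_kernel hT hTmean hΨ x
  have hcov : ∀ x y, covK P β x y = sumK N (fun l => a l ^ 2 * angularPower P T l) x y :=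
    fun x y => by
      rw [hβT, covK, integral_kernel_mul_kernel hT hG hΨ hΨ,
        conv_sumK_conv_sumK hG N a _ fun l _ => hc l]
  have hβG : ZonalKernel (covK P β) := by
    rw [show covK P β = _ from funext fun x => funext (hcov x)]
    exact zonalKernel_sumK _ _
  -- The series is the variance of the needlet field at the pole, so the normalising root equals
  -- `1`.
  have hnorm : ∑' l : ℕ, b ((l : ℝ) / B ^ j) ^ 2 *
      ((2 * (l : ℝ) + 1) / (4 * Real.pi)) * angularPower P T l = 1 := by
    refine Eq.trans ?_ (hvar pole)
    simp_rw [sq (β _ _)]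
    refine Eq.trans ?_ (hcov pole pole).symm
    rw [tsum_eq_sum (s := Finset.range N), sumK]
    · exact Finset.sum_congr rfl fun l _ => by rw [legK_self, ha]; ring
    · intro l hl
      rw [hN l (by simpa using hl)]
      simp
  -- the Hermite field
  set X : S2 → Ω → ℝ := fun y ω => (hermiteR (n + 2)).eval (β y ω) with hX
  have hX2 : L2Field X P := l2Field_hermite hβ2.measurable hβg hβ0 hvar _
  have hX0 : ∀ x, ∫ ω, X x ω ∂P = 0 := fun x =>
    integral_hermiteR (hβg.hasGaussianLaw_eval x) (hβ0 x) (hvar x) _ (by omega)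
  -- Large enough to contain every degree of the power `ρ^(n+2)` and every degree present in `K`.
  set M : ℕ := (n + 2) * N + (LK + 1) with hM
  set e : ℕ → ℝ := fun L => ∑' ls : Fin (n + 2) → ℕ, cgConvolution (n + 2) ls L *
    ∏ k, (b ((ls k : ℝ) / B ^ j) ^ 2 * ((2 * (ls k : ℝ) + 1) / (4 * Real.pi)) *
      angularPower P T (ls k)) with he
  have he' : ∀ L, e L = ∑ ls ∈ Fintype.piFinset fun _ : Fin (n + 2) => Finset.range N,
      cgConvolution (n + 2) ls L * ∏ k, (a (ls k) ^ 2 * angularPower P T (ls k) *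
        ((2 * (ls k : ℝ) + 1) / (4 * Real.pi))) := fun L => by
    simp only [he]
    rw [tsum_eq_sum (s := Fintype.piFinset fun _ : Fin (n + 2) => Finset.range N)]
    · refine Finset.sum_congr rfl fun ls _ => ?_
      congr 1
      exact Finset.prod_congr rfl fun k _ => by ring
    · intro ls hls
      rw [Fintype.mem_piFinset] at hls
      push Not at hls
      obtain ⟨k, hk⟩ := hls
      rw [Finset.prod_eq_zero (Finset.mem_univ k), mul_zero]
      rw [hN _ (by simpa using hk)]
      simp
  -- Coefficients with respect to `legK L` rather than `P_L`; the weight divided out here returns at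
  -- the end, which is why no factor `(2ℓ+1)/(4π)` of the output degree appears in the result.
  set d : ℕ → ℝ := fun L => ((n + 2)! : ℝ) * e L / ((2 * (L : ℝ) + 1) / (4 * Real.pi)) with hd
  have hXcov : ∀ x y, covK P X x y = sumK M d x y := fun x y => by
    rw [covK_hermite hβg hβ0 hvar, hcov, sumK_pow N M (by omega), hd,
      ← sum_mul_legendreP_eq_sumK, Finset.mul_sum]
    exact Finset.sum_congr rfl fun L _ => by rw [he', mul_assoc]
  have hXG : covK P X = sumK M d := funext fun x => funext (hXcov x)
  have hXz : ZonalKernel (covK P X) := hXG ▸ zonalKernel_sumK _ _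
  have hA := zonalKernel_sumK (LK + 1) κ
  have hg : gField P T b B j K (n + 2) =
      fun x ω => ∫ u, sumK (LK + 1) κ x u * X u ω ∂area := by
    funext x ω
    rw [gField]
    refine integral_congr_ae (Filter.Eventually.of_forall fun u => ?_)
    beta_reduce
    rw [hK _ (dot_mem_Icc x u), aeval_hermite, normalizedNeedletField, hnorm, Real.sqrt_one,
      div_one]
    congr 1
    exact Finset.sum_congr rfl fun l _ => by rw [legK]; ring
  rw [hg]
  refine ⟨(l2Field_integral_kernel hX2 hXz hA).memLp, integral_integral_kernel hX2 hX0 hA,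
    isIsotropic_integral_comp hT hβg hβ0 hβG N a (fun x ω => congrFun (congrFun hβT x) ω) hA
      (hermiteR (n + 2)).continuous.measurable, fun x₁ x₂ => ?_⟩
  rw [integral_kernel_mul_kernel hX2 hXz hA hA, hXG,
    conv_sumK_conv_sumK (zonalKernel_sumK M d) (LK + 1) κ d
      fun l hl => conv_legK_sumK M d (by omega), sumK, Finset.mul_sum]
  refine Finset.sum_congr rfl fun l _ => ?_
  have hpi := Real.pi_pos
  have h4 : (2 * (l : ℝ) + 1) / (4 * Real.pi) ≠ 0 := by positivity
  have hdl : d l * ((2 * (l : ℝ) + 1) / (4 * Real.pi)) = ((n + 2)! : ℝ) * e l :=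
    div_mul_cancel₀ _ h4
  rw [legK, mul_assoc, ← mul_assoc (d l), hdl]
  ring
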